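/- For $m\ge 1$ consider the linear optical circuit on $4m$ modes with transfer matrix $(I_4\otimes F_m)\bigl((I_2\otimes F_2)\oplus(F_2\otimes I_{2(m-1)})\bigr)$, where $F_d$ is the $d$-dimensional discrete Fourier matrix and the left tensor factor carries the fastest-varying mode index. Two dual-rail qubits enter in the first four modes, one photon enters each of the remaining $4(m-1)$ modes, and all modes are measured by photon-number-resolving detectors. Let $|\psi^\pm\rangle=(|01\rangle\pm|10\rangle)/\sqrt2$ and $|\phi^\pm\rangle=(|00\rangle\pm|11\rangle)/\sqrt2$ be the Bell states. After grouping of detection patterns into outcomes, the circuit realizes the two-qubit measurement with Kraus operators $$\langle\psi^+|,\quad \langle\psi^-|,\quad \sqrt{1-\tfrac1m}\,\langle\phi^+|,\quad K_k=\sqrt{\binom mk}\,\frac1{2^{m/2}}\Bigl[\langle\phi^-|+\frac{m-2k}{m}\langle\phi^+|\Bigr]\quad(k=0,\dots,m).$$ Let $P_m$ be the average success probability of Bell-state discrimination with this measurement: the four Bell states are equally likely, and success means that an outcome occurs that is impossible for the three other Bell states. For a measurement with POVM elements $M_i=K_i^\dagger K_i$, let its relative entropy of entanglement $E_m$ be the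 infimum, over all separable measurements $(N_i)$ with the same outcomes, of the relative entropy (base $2$) $\sum_i S(M_i/4\,\|\,N_i/4)$ of the Choi states. Then: 1. for even $m$, $$P_m=\frac14\Bigl(3-\frac1m+\binom m{m/2}\frac1{2^m}\Bigr);$$ 2. for every $m\ge1$, $$E_m=\frac14\Bigl[3-\frac1m+\sum_{k=0}^m\binom mk\frac1{2^{m-1}}F\Bigl(\frac km\Bigr)\Bigr],\qquad F(x)=\sum_{p\in\{x,1-x\}}-p^2\log_2\frac{p^2}{x^2+(1-x)^2}$$ (the sum in $F$ has one term for $p=x$ and one for $p=1-x$, also when these are equal, and $0\log_2 0=0$); the average $\sum_i\frac{\operatorname{tr}M_i}{4}E_R(M_i/\operatorname{tr}M_i)$, with $E_R$ the relative entropy of entanglement of states, has the same value; 3. as $m\to\infty$, $P_m\to\frac34$ and $E_m\to1$; 4. the maximum of $P_m$ over all $m\ge1$ is $P_8=\frac{403}{512}$. -/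

import Mathlib

open scoped Matrix Kronecker ComplexOrder

noncomputable section

namespace BellLOC

/-! ### Two-qubit states and measurements -/

/-- Index set of the computational basis of two qubits. -/
abbrev TwoQubit := Fin 2 × Fin 2

/-- Operators on the two-qubit space. -/
abbrev Op := Matrix TwoQubit TwoQubit ℂ

/-- The bra (or ket) with real coefficients `c x y` on `|x y⟩`. -/
def ofReals (c : Fin 2 → Fin 2 → ℝ) : TwoQubit → ℂ := fun p => (c p.1 p.2 : ℂ)

/-- `ψ⁺ = (|01⟩ + |10⟩)/√2`. -/
def psiPlus : TwoQubit → ℂ := ofReals ![![0, 1 / √2], ![1 / √2, 0]]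

/-- `ψ⁻ = (|01⟩ - |10⟩)/√2`. -/
def psiMinus : TwoQubit → ℂ := ofReals ![![0, 1 / √2], ![-(1 / √2), 0]]

/-- `φ⁺ = (|00⟩ + |11⟩)/√2`. -/
def phiPlus : TwoQubit → ℂ := ofReals ![![1 / √2, 0], ![0, 1 / √2]]

/-- `φ⁻ = (|00⟩ - |11⟩)/√2`. -/
def phiMinus : TwoQubit → ℂ := ofReals ![![1 / √2, 0], ![0, -(1 / √2)]]

/-- The four Bell states. -/
def bell : Fin 4 → TwoQubit → ℂ := ![psiPlus, psiMinus, phiPlus, phiMinus]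

/-- A destructive measurement with outcome set `ι` is given by one bra `K i` (a Kraus operator
with one-dimensional output space) per outcome. -/
abbrev BraFamily (ι : Type) := ι → TwoQubit → ℂ

/-- The amplitude `⟨k|v⟩` of a bra on a ket. -/
def applyBra (k v : TwoQubit → ℂ) : ℂ := ∑ x, k x * v x

/-- The POVM element `K†K` of a bra `K`. -/
def effect (k : TwoQubit → ℂ) : Op := Matrix.vecMulVec (star k) k

/-! ### Linear optical circuits -/

section Optics

variable {M : Type} [Fintype M] [DecidableEq M]

/-- Matrix element `⟨n| B(U) |n'⟩` of the evolution of Fock states under the transfer matrix `U`: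
each creation operator `a_i†` is replaced by `∑ j, U j i • a_j†`, where the Fock state `|n⟩` is
`∏ i, (a_i†)^(n i) / √(n i)!` applied to the vacuum. Creation operators commute, so they are the
variables of a polynomial ring. -/
def fockAmplitude (U : Matrix M M ℂ) (n n' : M →₀ ℕ) : ℂ :=
  ((√((∏ i, (n i).factorial : ℕ) : ℝ) / √((∏ i, (n' i).factorial : ℕ) : ℝ) : ℝ) : ℂ) *
    MvPolynomial.coeff n
      (∏ i, (∑ j, MvPolynomial.C (U j i) * MvPolynomial.X j) ^ (n' i))

end Optics

/-- The `m`-dimensional discrete Fourier matrix. -/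
def fourier (m : ℕ) : Matrix (Fin m) (Fin m) ℂ :=
  Matrix.of fun j k =>
    Complex.exp (2 * Real.pi * Complex.I * ((j : ℕ) : ℂ) * ((k : ℕ) : ℂ) / (m : ℂ)) / ((√m : ℝ) : ℂ)

/-- The `4m` optical modes: `(j, s, t)` is mode number `4j + 2s + t`. -/
abbrev Mode (m : ℕ) := Fin m × Fin 2 × Fin 2

/-- First layer of beam splitters. On the four qubit modes (`j = 0`), `F_2` acts on the index `s`
(it couples modes `0, 2` and modes `1, 3`). On the ancilla modes (`j ≥ 1`), `F_2` acts on the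
index `t` (it couples the adjacent modes `2i, 2i + 1`). -/
def firstLayer (m : ℕ) : Matrix (Mode m) (Mode m) ℂ :=
  Matrix.of fun p q =>
    if p.1 = q.1 then
      if (p.1 : ℕ) = 0 then
        (fourier 2 ⊗ₖ (1 : Matrix (Fin 2) (Fin 2) ℂ)) p.2 q.2
      else
        ((1 : Matrix (Fin 2) (Fin 2) ℂ) ⊗ₖ fourier 2) p.2 q.2
    else 0

/-- The transfer matrix of the whole circuit: after the first layer, for each of the four values of
`(s, t)` the `m` modes `(j, s, t)`, `j = 0, …, m-1`, undergo the Fourier transform `F_m`. -/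
def circuit (m : ℕ) : Matrix (Mode m) (Mode m) ℂ :=
  (fourier m ⊗ₖ (1 : Matrix (Fin 2 × Fin 2) (Fin 2 × Fin 2) ℂ)) * firstLayer m

/-- The input Fock state for the two-qubit basis state `|x y⟩`: in dual-rail encoding, the first
qubit occupies modes `0, 1`, the second one modes `2, 3`, and the photon of a qubit with value `t`
is in the mode of the pair that has index `t`. All `4(m-1)` ancilla modes hold one photon. -/
def inputPhotons (m : ℕ) (x : TwoQubit) : Mode m →₀ ℕ :=
  Finsupp.equivFunOnFinite.symm fun p =>
    if (p.1 : ℕ) = 0 then (if p.2.2 = ![x.1, x.2] p.2.1 then 1 else 0) else 1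

/-- The Kraus operator (bra) on the two qubits for the detection pattern `n`. -/
def patternBra (m : ℕ) : BraFamily (Mode m →₀ ℕ) :=
  fun n x => fockAmplitude (circuit m) n (inputPhotons m x)

/-- All detection patterns of the `2 + 4(m-1)` photons. -/
def patterns (m : ℕ) : Finset (Mode m →₀ ℕ) :=
  Finset.finsuppAntidiag Finset.univ (2 + 4 * (m - 1))

/-- The circuit realizes the measurement `K`: after sorting the detection patterns according to
some function `f` into the outcomes of `K`, every outcome has the POVM element of `K`.
(As these have rank at most one, the bras of all patterns sorted into one outcome are then
proportional to its Kraus operator.) -/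
def CircuitRealizes {ι : Type} [DecidableEq ι] (m : ℕ) (K : BraFamily ι) : Prop :=
  ∃ f : (Mode m →₀ ℕ) → ι, ∀ i,
    ∑ n ∈ (patterns m).filter (fun n => f n = i), effect (patternBra m n) = effect (K i)

/-- Outcomes of the two-qubit measurement: three Bell outcomes, and `K_0, …, K_m`. -/
abbrev Outcome (m : ℕ) := Fin 3 ⊕ Fin (m + 1)

/-- The Kraus operators
`⟨ψ⁺|, ⟨ψ⁻|, √(1 - 1/m) ⟨φ⁺|, K_k = √(m choose k) / 2^(m/2) (⟨φ⁻| + (m - 2k)/m ⟨φ⁺|)`. -/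
def bellKraus (m : ℕ) : BraFamily (Outcome m) :=
  Sum.elim
    ![psiPlus, psiMinus, ((√(1 - 1 / (m : ℝ)) : ℝ) : ℂ) • phiPlus]
    (fun k => ((√(m.choose k) / √(2 ^ m) : ℝ) : ℂ) •
      (phiMinus + ((((m : ℝ) - 2 * (k : ℕ)) / m : ℝ) : ℂ) • phiPlus))

/-! ### Bell-state discrimination -/

/-- The bra `k` identifies the Bell state `b`: it vanishes on the three other ones. -/
def Identifies (k : TwoQubit → ℂ) (b : Fin 4) : Prop :=
  ∀ b', b' ≠ b → applyBra k (bell b') = 0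

open Classical in
/-- Average success probability of (unambiguous) Bell-state discrimination: the four Bell states
are equally likely, and success means an outcome that identifies the given one. -/
def successProb {ι : Type} [Fintype ι] (K : BraFamily ι) : ℝ :=
  1 / 4 * ∑ b, ∑ i, if Identifies (K i) b then ‖applyBra (K i) (bell b)‖ ^ 2 else 0

/-! ### Relative entropy of entanglement -/

/-- Quantum relative entropy `tr A (log₂ A - log₂ B)` of positive semidefinite operators
(not necessarily normalized), with value `⊤` unless the support of `A` lies in that of `B`.
The functional calculus uses `Real.log 0 = 0`, i.e. the logarithm on the support. -/
def relEntropy (A B : Op) : EReal :=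
  open Classical in
  if ∀ v, B *ᵥ v = 0 → A *ᵥ v = 0 then
    (((A * (cfc Real.log A - cfc Real.log B)).trace.re / Real.log 2 : ℝ) : EReal)
  else ⊤

/-- Separable positive operators: finite sums of tensor products of positive operators. -/
def IsSeparable (N : Op) : Prop :=
  ∃ (r : ℕ) (A B : Fin r → Matrix (Fin 2) (Fin 2) ℂ),
    (∀ i, (A i).PosSemidef) ∧ (∀ i, (B i).PosSemidef) ∧ N = ∑ i, A i ⊗ₖ B i

/-- Relative entropy of entanglement of a two-qubit state. -/
def stateREE (ρ : Op) : EReal :=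
  ⨅ (σ : Op) (_ : IsSeparable σ ∧ σ.trace = 1), relEntropy ρ σ

/-- Separable two-qubit measurements (POVMs). -/
def IsSeparableMeasurement {ι : Type} [Fintype ι] (N : ι → Op) : Prop :=
  (∀ i, IsSeparable (N i)) ∧ ∑ i, N i = 1

/-- Relative entropy of two measurements: the relative entropy of their Choi states
`⨁ i, M i / 4` and `⨁ i, N i / 4`, which is the sum over the blocks. -/
def measurementRelEntropy {ι : Type} [Fintype ι] (M N : ι → Op) : EReal :=
  ∑ i, relEntropy ((1 / 4 : ℂ) • M i) ((1 / 4 : ℂ) • N i)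

/-- Relative entropy of entanglement of a measurement: its relative-entropy distance to the
separable measurements with the same outcomes. -/
def measurementREE {ι : Type} [Fintype ι] (K : BraFamily ι) : EReal :=
  ⨅ (N : ι → Op) (_ : IsSeparableMeasurement N), measurementRelEntropy (fun i => effect (K i)) N

/-- The average, over the outcomes for the maximally mixed input `1/4`, of the relative entropy of
entanglement of the state `M i / tr (M i)` onto which outcome `i` projects. -/
def averageREE {ι : Type} [Fintype ι] (K : BraFamily ι) : EReal :=
  ∑ i, (((effect (K i)).trace.re / 4 : ℝ) : EReal) *
    stateREE ((effect (K i)).trace⁻¹ • effect (K i))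

/-! ### The explicit values -/

/-- One summand `-p² log₂ (p² / (x² + (1-x)²))` of `F`. -/
def entropyTerm (x p : ℝ) : ℝ := -p ^ 2 * Real.logb 2 (p ^ 2 / (x ^ 2 + (1 - x) ^ 2))

/-- `F(x) = ∑_{p = x, 1-x} -p² log₂ (p² / (x² + (1-x)²))`. -/
def F (x : ℝ) : ℝ := entropyTerm x x + entropyTerm x (1 - x)

/-- The binomial sum for the relative entropy of entanglement. -/
def entanglementValue (m : ℕ) : ℝ :=
  1 / 4 * (3 - 1 / (m : ℝ) +
    ∑ k ∈ Finset.range (m + 1), (m.choose k : ℝ) * (1 / 2 ^ (m - 1)) * F ((k : ℝ) / m))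

end BellLOC

end

open BellLOC

set_option linter.unusedSectionVars false

noncomputable section

namespace BellLOC

open Matrix

/-! ### Functional calculus and logarithms of Hermitian matrices -/

section Spectral

variable {n : Type} [Fintype n] [DecidableEq n]

/-! The circuit, the entanglement and the discrimination are independent problems.

Entanglement. Every Kraus bra has computational basis vectors as Schmidt basis. A separable `B`
satisfies the reduction criterion `B ≤ B₁ ⊗ 1`, where `B₁` is its reduced operator. Operator
monotonicity of the logarithm, Jensen's inequality for the diagonal of `log B₁` and `a log b ≤ a log
a + b - a` bound the relative entropy of `effect k` to `B` below by the Schmidt entropy of `k` plus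
`(tr (effect k) - tr B) / log 2` (`InSchmidtForm.le_relEntropy`). Over a whole measurement the trace
terms cancel. Equality holds for the diagonal parts of the effects, which themselves form a
separable measurement. Hence both entanglement quantities are a quarter of the summed Schmidt
entropies. Their binomial sum is a Bernstein approximation of `F` at `1/2`, which gives the limit.

Discrimination. Among the `K_k` only the one with `m = 2k` identifies a Bell state. The central
binomial weight decreases to zero, so a finite check finds the maximum.

Circuit. Creation operators are polynomial variables and a transfer matrix is a linear substitution.
After the first layer, `ψ⁺`, `ψ⁻` and `φ±` have three different photon-number parities, and each
ancilla pair is in a state proportional to `a₀² - a₁²`. The states `φ±` are superpositions of two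
branches, each a product over `2m - 1` pairs. In `φ⁻` all pairs carry the minus sign, so cyclic
shifts of the row that is full in the branch leave it invariant; in `φ⁺` the sign of one pair is
flipped. The Fourier layer preserves the photon number of every `(s, t)` and turns shifts into
phases. A pattern with a nontrivial phase excludes `φ⁻`. For all other patterns the `φ⁺` amplitude
equals its mean over the shifts, which is `(m - 2k)/m` times the `φ⁻` amplitude if `k` pairs of the
row are in the second position (`coeff_branchState_flipSign`). Unitarity (`fockInner_linSubst`)
reduces the probability of level `k` to a count of subsets, and the binomial variance leaves `1 -
1/m` for the outcome `φ⁺`. -/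

lemma conj_diagonal_isHermitian (V : Matrix n n ℂ) (d : n → ℝ) :
    (V * diagonal (fun i => (d i : ℂ)) * Vᴴ).IsHermitian := by
  unfold Matrix.IsHermitian
  rw [conjTranspose_mul, conjTranspose_mul, conjTranspose_conjTranspose, diagonal_conjTranspose,
    Matrix.mul_assoc]
  congr 3
  ext i
  simp

/-- The functional calculus of a matrix given by a spectral decomposition. -/
lemma cfc_conj_diagonal (f : ℝ → ℝ) {V : Matrix n n ℂ} (hV : Vᴴ * V = 1) (d : n → ℝ) :
    cfc f (V * diagonal (fun i => (d i : ℂ)) * Vᴴ) =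
      V * diagonal (fun i => (f (d i) : ℂ)) * Vᴴ := by
  have hV' : V * Vᴴ = 1 := mul_eq_one_comm.mp hV
  have key : ∀ q : Polynomial ℝ,
      Polynomial.aeval (V * diagonal (fun i => (d i : ℂ)) * Vᴴ) q =
        V * diagonal (fun i => ((q.eval (d i) : ℝ) : ℂ)) * Vᴴ := by
    intro q
    induction q using Polynomial.induction_on' with
    | add p q hp hq =>
      rw [map_add, hp, hq, ← Matrix.add_mul, ← Matrix.mul_add, diagonal_add]
      simp
    | monomial k a =>
      have hpow : ∀ k : ℕ, (V * diagonal (fun i => (d i : ℂ)) * Vᴴ) ^ k =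
          V * diagonal (fun i => ((d i : ℂ)) ^ k) * Vᴴ := by
        intro k
        induction k with
        | zero => simp [hV']
        | succ k ih =>
          rw [pow_succ, ih]
          calc _ = V * diagonal (fun i => ((d i : ℂ)) ^ k) * (Vᴴ * V) *
              diagonal (fun i => (d i : ℂ)) * Vᴴ := by simp only [Matrix.mul_assoc]
            _ = _ := by
              rw [hV, Matrix.mul_one, Matrix.mul_assoc V, diagonal_mul_diagonal]
              simp [pow_succ]
      rw [Polynomial.aeval_monomial, hpow, ← Algebra.smul_def, ← Matrix.smul_mul, ← Matrix.mul_smul]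
      congr 2
      ext i j
      by_cases h : i = j
      · subst h
        simp
      · simp [diagonal_apply_ne _ h]
  have hA := conj_diagonal_isHermitian V d
  classical
  -- Interpolating `f` at both lists of eigenvalues, the canonical one and `d`, reduces the claim to
  -- polynomials without matching the lists.
  set s : Finset ℝ := Finset.univ.image hA.eigenvalues ∪ Finset.univ.image d
  set q : Polynomial ℝ := Lagrange.interpolate s id f
  have hq : ∀ x ∈ s, q.eval x = f x := fun x hx =>
    Lagrange.eval_interpolate_at_node f Function.injective_id.injOn hx
  have h1 : cfc f (V * diagonal (fun i => (d i : ℂ)) * Vᴴ) =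
      cfc q.eval (V * diagonal (fun i => (d i : ℂ)) * Vᴴ) := by
    apply cfc_congr
    intro x hx
    rw [hA.spectrum_real_eq_range_eigenvalues] at hx
    obtain ⟨i, rfl⟩ := hx
    exact (hq _ (by simp [s])).symm
  rw [h1, cfc_polynomial q _ hA.isSelfAdjoint, key]
  congr 3
  ext i
  rw [hq _ (by simp [s])]

lemma exists_conj_diagonal {B : Matrix n n ℂ} (hB : B.IsHermitian) :
    ∃ (V : Matrix n n ℂ) (d : n → ℝ), Vᴴ * V = 1 ∧
      B = V * diagonal (fun i => (d i : ℂ)) * Vᴴ := by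
  refine ⟨hB.eigenvectorUnitary, hB.eigenvalues, ?_, ?_⟩
  · exact Unitary.coe_star_mul_self hB.eigenvectorUnitary
  · conv_lhs => rw [hB.spectral_theorem]
    rfl

/-- Turns matrix inequalities for logarithms into scalar ones: the quadratic form is a sum of
eigenvalues with nonnegative weights. -/
lemma quadForm_conj_diagonal (V : Matrix n n ℂ) (d : n → ℝ) (u : n → ℂ) :
    star u ⬝ᵥ ((V * diagonal (fun i => (d i : ℂ)) * Vᴴ) *ᵥ u) =
      ((∑ i, d i * ‖(Vᴴ *ᵥ u) i‖ ^ 2 : ℝ) : ℂ) := by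
  rw [← mulVec_mulVec, ← mulVec_mulVec, dotProduct_mulVec]
  have : star u ᵥ* V = star (Vᴴ *ᵥ u) := by
    rw [star_mulVec, conjTranspose_conjTranspose]
  rw [this]
  simp only [dotProduct, mulVec_diagonal, Pi.star_apply]
  push_cast
  refine Finset.sum_congr rfl fun i _ => ?_
  rw [← Complex.conj_mul']
  simp only [RCLike.star_def]
  ring

lemma conj_diagonal_add_smul_one {V : Matrix n n ℂ} (hV : Vᴴ * V = 1) (d : n → ℝ) (ε : ℝ) :
    V * diagonal (fun i => (d i : ℂ)) * Vᴴ + (ε : ℂ) • 1 =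
      V * diagonal (fun i => ((d i + ε : ℝ) : ℂ)) * Vᴴ := by
  have hV' : V * Vᴴ = 1 := mul_eq_one_comm.mp hV
  have : diagonal (fun i => ((d i + ε : ℝ) : ℂ)) =
      diagonal (fun i => (d i : ℂ)) + (ε : ℂ) • (1 : Matrix n n ℂ) := by
    rw [smul_one_eq_diagonal, diagonal_add]
    simp
  rw [this, Matrix.mul_add, Matrix.add_mul]
  simp [hV']

lemma nonneg_of_conj_diagonal_posSemidef {V : Matrix n n ℂ} (hV : Vᴴ * V = 1) {d : n → ℝ}
    (h : (V * diagonal (fun i => (d i : ℂ)) * Vᴴ).PosSemidef) (i : n) : 0 ≤ d i := by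
  have h1 := h.conjTranspose_mul_mul_same V
  have h2 : Vᴴ * (V * diagonal (fun i => (d i : ℂ)) * Vᴴ) * V = diagonal (fun i => (d i : ℂ)) := by
    calc _ = (Vᴴ * V) * diagonal (fun i => (d i : ℂ)) * (Vᴴ * V) := by
          simp only [Matrix.mul_assoc]
      _ = _ := by rw [hV]; simp
  rw [h2, posSemidef_diagonal_iff] at h1
  exact_mod_cast h1 i

/-- The matrix logarithm is operator monotone. -/
lemma quadForm_log_le {A B : Matrix n n ℂ} (hA : A.PosDef) (hAB : (B - A).PosSemidef)
    (u : n → ℂ) :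
    (star u ⬝ᵥ (cfc Real.log A *ᵥ u)).re ≤ (star u ⬝ᵥ (cfc Real.log B *ᵥ u)).re := by
  open scoped Matrix.Norms.L2Operator MatrixOrder in
  have h : CFC.log A ≤ CFC.log B := by
    refine CFC.log_le_log (Matrix.le_iff.mpr hAB) ?_
    exact Matrix.isStrictlyPositive_iff_posDef.mpr hA
  have h2 : (cfc Real.log B - cfc Real.log A).PosSemidef := Matrix.le_iff.mp h
  have h3 := h2.dotProduct_mulVec_nonneg u
  rw [sub_mulVec, dotProduct_sub] at h3
  have := (Complex.le_def.mp h3).1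
  simpa using this

end Spectral

section LogBounds

variable {n : Type} [Fintype n] [DecidableEq n]

lemma sum_normSq_conj_mulVec {V : Matrix n n ℂ} (hV : Vᴴ * V = 1) (u : n → ℂ) :
    ∑ i, ‖(Vᴴ *ᵥ u) i‖ ^ 2 = ∑ i, ‖u i‖ ^ 2 := by
  have hV' : V * Vᴴ = 1 := mul_eq_one_comm.mp hV
  have h := quadForm_conj_diagonal V (fun _ => 1) u
  have h1 : diagonal (fun _ : n => ((1 : ℝ) : ℂ)) = 1 := by simp
  rw [h1, Matrix.mul_one, hV', one_mulVec] at h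
  have h2 : star u ⬝ᵥ u = ((∑ i, ‖u i‖ ^ 2 : ℝ) : ℂ) := by
    simp only [dotProduct, Pi.star_apply, RCLike.star_def, Complex.conj_mul']
    push_cast
    rfl
  rw [h2] at h
  simpa using (Complex.ofReal_injective h).symm

/-- Adding a positive multiple of the identity increases the logarithm on the support. -/
lemma quadForm_log_le_add {B : Matrix n n ℂ} (hB : B.PosSemidef) {u : n → ℂ}
    (hu : ∀ v, B *ᵥ v = 0 → star u ⬝ᵥ v = 0) {ε : ℝ} (hε : 0 < ε) :
    (star u ⬝ᵥ (cfc Real.log B *ᵥ u)).re ≤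
      (star u ⬝ᵥ (cfc Real.log (B + (ε : ℂ) • 1) *ᵥ u)).re := by
  obtain ⟨V, d, hV, rfl⟩ := exists_conj_diagonal hB.isHermitian
  have hd := nonneg_of_conj_diagonal_posSemidef hV hB
  rw [conj_diagonal_add_smul_one hV, cfc_conj_diagonal _ hV, cfc_conj_diagonal _ hV,
    quadForm_conj_diagonal, quadForm_conj_diagonal, Complex.ofReal_re, Complex.ofReal_re]
  refine Finset.sum_le_sum fun i _ => ?_
  -- At a zero eigenvalue the convention `Real.log 0 = 0` may exceed `log ε`. But then column `i` of
  -- `V` lies in the kernel, so `u` has no weight there.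
  rcases (hd i).eq_or_lt with h0 | h0
  · have h1 : (V * diagonal (fun i => (d i : ℂ)) * Vᴴ) *ᵥ (V *ᵥ Pi.single i 1) = 0 := by
      rw [mulVec_mulVec, Matrix.mul_assoc, hV, Matrix.mul_one, ← mulVec_mulVec,
        diagonal_mulVec_single]
      simp [← h0]
    have h2 := hu _ h1
    have h3 : (Vᴴ *ᵥ u) i = 0 := by
      rw [dotProduct_mulVec] at h2
      have : star u ᵥ* V = star (Vᴴ *ᵥ u) := by
        rw [star_mulVec, conjTranspose_conjTranspose]
      rw [this] at h2
      simpa using h2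
    simp [h3]
  · exact mul_le_mul_of_nonneg_right (Real.log_le_log h0 (by linarith)) (by positivity)

end LogBounds

/-! ### Reduction criterion and the entropy bound for separable operators -/

/-- The reduced operator on the first qubit. -/
def reduceFst (B : Op) : Matrix (Fin 2) (Fin 2) ℂ := of fun x x' => ∑ y, B (x, y) (x', y)

lemma reduceFst_kronecker (A B : Matrix (Fin 2) (Fin 2) ℂ) :
    reduceFst (A ⊗ₖ B) = B.trace • A := by
  ext x x'
  simp [reduceFst, trace, kroneckerMap_apply, ← Finset.mul_sum, mul_comm]

lemma reduceFst_sum {ι : Type} (s : Finset ι) (B : ι → Op) :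
    reduceFst (∑ i ∈ s, B i) = ∑ i ∈ s, reduceFst (B i) := by
  ext x x'
  simp only [reduceFst, of_apply, Matrix.sum_apply]
  exact Finset.sum_comm

/-- For a qubit, `tr B • 1 - B` is the spin flip of `B`: the transpose conjugated by a real
antisymmetric unitary. -/
lemma trace_smul_one_sub_posSemidef {B : Matrix (Fin 2) (Fin 2) ℂ} (hB : B.PosSemidef) :
    (B.trace • 1 - B).PosSemidef := by
  have h := hB.transpose.mul_mul_conjTranspose_same !![(0 : ℂ), 1; -1, 0]
  have heq : B.trace • 1 - B = !![(0 : ℂ), 1; -1, 0] * Bᵀ * !![(0 : ℂ), 1; -1, 0]ᴴ := by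
    ext i j
    fin_cases i <;> fin_cases j <;>
      simp [vecMul, dotProduct, Matrix.mul_apply, trace, Fin.sum_univ_two]
  rwa [heq]

lemma IsSeparable.posSemidef {N : Op} (h : IsSeparable N) : N.PosSemidef := by
  obtain ⟨r, A, B, hA, hB, rfl⟩ := h
  exact posSemidef_sum _ fun i _ => (hA i).kronecker (hB i)

/-- The reduction criterion. -/
lemma IsSeparable.reduction {N : Op} (h : IsSeparable N) :
    (reduceFst N ⊗ₖ (1 : Matrix (Fin 2) (Fin 2) ℂ) - N).PosSemidef := by
  obtain ⟨r, A, B, hA, hB, rfl⟩ := h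
  have : reduceFst (∑ i, A i ⊗ₖ B i) ⊗ₖ (1 : Matrix (Fin 2) (Fin 2) ℂ) - ∑ i, A i ⊗ₖ B i =
      ∑ i, A i ⊗ₖ ((B i).trace • 1 - B i) := by
    rw [reduceFst_sum]
    ext ⟨x, y⟩ ⟨x', y'⟩
    simp only [reduceFst_kronecker, Matrix.sub_apply, kroneckerMap_apply, Matrix.sum_apply,
      Matrix.smul_apply, smul_eq_mul, Finset.sum_mul, ← Finset.sum_sub_distrib]
    refine Finset.sum_congr rfl fun i _ => ?_
    ring
  rw [this]
  exact posSemidef_sum _ fun i _ => (hA i).kronecker (trace_smul_one_sub_posSemidef (hB i))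

lemma IsSeparable.reduceFst_posSemidef {N : Op} (h : IsSeparable N) :
    (reduceFst N).PosSemidef := by
  obtain ⟨r, A, B, hA, hB, rfl⟩ := h
  rw [reduceFst_sum]
  refine posSemidef_sum _ fun i _ => ?_
  rw [reduceFst_kronecker]
  exact (hA i).smul (hB i).trace_nonneg

lemma trace_reduceFst (B : Op) : (reduceFst B).trace = B.trace := by
  simp [trace, reduceFst, Fintype.sum_prod_type]

/-- Weight of the value `x` of the first qubit. -/
def rowWeight (u : TwoQubit → ℂ) (x : Fin 2) : ℝ := ∑ y, ‖u (x, y)‖ ^ 2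

lemma rowWeight_nonneg (u : TwoQubit → ℂ) (x : Fin 2) : 0 ≤ rowWeight u x :=
  Finset.sum_nonneg fun _ _ => by positivity

/-- Quadratic form of `L ⊗ 1` at a vector whose two rows are orthogonal. -/
lemma quadForm_kronecker_one {u : TwoQubit → ℂ} (hu : ∑ y, u (0, y) * star (u (1, y)) = 0)
    (L : Matrix (Fin 2) (Fin 2) ℂ) :
    star u ⬝ᵥ ((L ⊗ₖ (1 : Matrix (Fin 2) (Fin 2) ℂ)) *ᵥ u) =
      ∑ x, (rowWeight u x : ℂ) * L x x := by
  have hu' : ∑ y, u (1, y) * star (u (0, y)) = 0 := by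
    have := congrArg star hu
    simpa [mul_comm] using this
  simp only [Fin.sum_univ_two] at hu hu'
  simp only [dotProduct, mulVec, Fintype.sum_prod_type, Fin.sum_univ_two, kroneckerMap_apply,
    rowWeight, Pi.star_apply]
  push_cast
  simp only [← Complex.conj_mul', ← RCLike.star_def, one_apply_eq,
    Matrix.one_apply_ne (zero_ne_one : (0 : Fin 2) ≠ 1),
    Matrix.one_apply_ne (one_ne_zero : (1 : Fin 2) ≠ 0)]
  linear_combination L 1 0 * hu + L 0 1 * hu'

/-- Jensen's inequality for diagonal entries of the logarithm. -/
lemma log_apply_le {T : Matrix (Fin 2) (Fin 2) ℂ} (hT : T.PosDef) (x : Fin 2) :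
    (cfc Real.log T x x).re ≤ Real.log (T x x).re := by
  obtain ⟨V, d, hV, rfl⟩ := exists_conj_diagonal hT.isHermitian
  have hd : ∀ i, 0 < d i := by
    have h1 := hT.conjTranspose_mul_mul_same (B := V)
      (Matrix.mulVec_injective_of_isUnit (IsUnit.of_mul_eq_one_right _ hV))
    have h2 : Vᴴ * (V * diagonal (fun i => (d i : ℂ)) * Vᴴ) * V =
        diagonal (fun i => (d i : ℂ)) := by
      calc _ = (Vᴴ * V) * diagonal (fun i => (d i : ℂ)) * (Vᴴ * V) := by
            simp only [Matrix.mul_assoc]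
        _ = _ := by rw [hV]; simp
    rw [h2, posDef_diagonal_iff] at h1
    intro i
    exact_mod_cast h1 i
  rw [cfc_conj_diagonal _ hV]
  have h : ∀ e : Fin 2 → ℝ, ((V * diagonal (fun i => (e i : ℂ)) * Vᴴ) x x).re =
      ∑ i, ‖(Vᴴ *ᵥ Pi.single x 1) i‖ ^ 2 * e i := by
    intro e
    have := quadForm_conj_diagonal V e (Pi.single x 1)
    rw [← Pi.single_star, single_dotProduct] at this
    simp only [mulVec_single_one, star_one, one_mul] at this
    have h2 := congrArg Complex.re this
    rw [Complex.ofReal_re] at h2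
    simp only [mulVec_single_one, mul_comm (_ ^ 2)]
    exact h2
  rw [h, h]
  refine strictConcaveOn_log_Ioi.concaveOn.le_map_sum (fun _ _ => by positivity) ?_
    fun i _ => hd i
  rw [sum_normSq_conj_mulVec hV]
  fin_cases x <;> simp

/-- This is `log t ≤ t - 1` at `t = b / a`. Being linear in `b`, the bound also serves unnormalized
operators, which enter only through their trace. -/
lemma mul_log_sub_le {a b : ℝ} (ha : 0 ≤ a) (hb : 0 < b) :
    a * Real.log b ≤ a * Real.log a + b - a := by
  rcases ha.eq_or_lt with rfl | ha
  · simpa using hb.le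
  · have h := Real.log_le_sub_one_of_pos (div_pos hb ha)
    rw [Real.log_div hb.ne' ha.ne'] at h
    have h2 := mul_le_mul_of_nonneg_left h ha.le
    have h3 : a * (b / a - 1) = b - a := by field_simp
    linarith

/-- The key inequality for the logarithm of a separable operator. -/
lemma quadForm_log_separable_le {B : Op} (hB : IsSeparable B) {u : TwoQubit → ℂ}
    (hu : ∑ y, u (0, y) * star (u (1, y)) = 0)
    (hs : ∀ v, B *ᵥ v = 0 → star u ⬝ᵥ v = 0) :
    (star u ⬝ᵥ (cfc Real.log B *ᵥ u)).re ≤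
      ∑ x, rowWeight u x * Real.log (rowWeight u x) + B.trace.re - ∑ x, rowWeight u x := by
  refine le_of_forall_pos_le_add fun δ hδ => ?_
  -- Monotonicity of the logarithm needs positive definite operators, hence the shift by `ε`. It
  -- raises the trace of the 2×2 reduced operator by `2 * ε = δ`.
  set ε : ℝ := δ / 2 with hε
  have hε0 : 0 < ε := by positivity
  have hεC : (0 : ℂ) < (ε : ℂ) := by exact_mod_cast hε0
  have hone : ∀ {n : Type} [Fintype n] [DecidableEq n],
      ((ε : ℂ) • (1 : Matrix n n ℂ)).PosDef := fun {n} _ _ => PosDef.one.smul hεC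
  set T := reduceFst B + (ε : ℂ) • 1 with hT
  have hTpos : T.PosDef := PosDef.posSemidef_add hB.reduceFst_posSemidef hone
  have h1 := quadForm_log_le_add hB.posSemidef hs hε0
  -- The shift by `ε` is the same on both sides, so the difference is exactly the one in the
  -- reduction criterion.
  have h2 : (star u ⬝ᵥ (cfc Real.log (B + (ε : ℂ) • 1) *ᵥ u)).re ≤
      (star u ⬝ᵥ (cfc Real.log (T ⊗ₖ (1 : Matrix (Fin 2) (Fin 2) ℂ)) *ᵥ u)).re := by
    refine quadForm_log_le (PosDef.posSemidef_add hB.posSemidef hone) ?_ u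
    have h := hB.reduction
    convert h using 1
    rw [hT, add_kronecker, smul_kronecker, one_kronecker_one]
    abel
  -- Tensoring with the identity only repeats the eigenvalues.
  have h3 : cfc Real.log (T ⊗ₖ (1 : Matrix (Fin 2) (Fin 2) ℂ)) =
      cfc Real.log T ⊗ₖ (1 : Matrix (Fin 2) (Fin 2) ℂ) := by
    obtain ⟨V, d, hV, hTV⟩ := exists_conj_diagonal hTpos.isHermitian
    have hk : ∀ e : Fin 2 → ℝ,
        (V * diagonal (fun i => (e i : ℂ)) * Vᴴ) ⊗ₖ (1 : Matrix (Fin 2) (Fin 2) ℂ) =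
        (V ⊗ₖ (1 : Matrix (Fin 2) (Fin 2) ℂ)) *
          diagonal (fun i : Fin 2 × Fin 2 => ((e i.1 : ℝ) : ℂ)) *
          (V ⊗ₖ (1 : Matrix (Fin 2) (Fin 2) ℂ))ᴴ := by
      intro e
      have : diagonal (fun i : Fin 2 × Fin 2 => ((e i.1 : ℝ) : ℂ)) =
          diagonal (fun i => (e i : ℂ)) ⊗ₖ (1 : Matrix (Fin 2) (Fin 2) ℂ) := by
        rw [← diagonal_one, diagonal_kronecker_diagonal]
        simp
      rw [this, conjTranspose_kronecker, conjTranspose_one, ← mul_kronecker_mul,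
        ← mul_kronecker_mul]
      simp
    have hV2 : (V ⊗ₖ (1 : Matrix (Fin 2) (Fin 2) ℂ))ᴴ * (V ⊗ₖ (1 : Matrix (Fin 2) (Fin 2) ℂ)) =
        1 := by
      rw [conjTranspose_kronecker, conjTranspose_one, ← mul_kronecker_mul, hV]
      simp
    rw [hTV, hk, cfc_conj_diagonal _ hV2, cfc_conj_diagonal _ hV, hk]
  rw [h3, quadForm_kronecker_one hu] at h2
  have h4 : (∑ x, (rowWeight u x : ℂ) * cfc Real.log T x x).re ≤
      ∑ x, (rowWeight u x * Real.log (rowWeight u x) + (T x x).re - rowWeight u x) := by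
    rw [Complex.re_sum]
    refine Finset.sum_le_sum fun x _ => ?_
    rw [Complex.re_ofReal_mul]
    have hTx : 0 < (T x x).re := (Complex.lt_def.mp hTpos.diag_pos).1
    exact (mul_le_mul_of_nonneg_left (log_apply_le hTpos x) (rowWeight_nonneg u x)).trans
      (mul_log_sub_le (rowWeight_nonneg u x) hTx)
  have h5 : ∑ x, (T x x).re = B.trace.re + δ := by
    rw [← trace_reduceFst]
    simp only [hT, trace, Fin.sum_univ_two, Matrix.add_apply, Matrix.smul_apply, one_apply_eq,
      Complex.add_re, diag_apply, smul_eq_mul, mul_one, Complex.ofReal_re, hε]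
    ring
  rw [Finset.sum_sub_distrib, Finset.sum_add_distrib, h5] at h4
  linarith

/-! ### Rank-one effects and the relative entropy of entanglement -/

lemma effect_eq (k : TwoQubit → ℂ) : effect k = vecMulVec (star k) (star (star k)) := by
  rw [star_star, effect]

lemma effect_posSemidef (k : TwoQubit → ℂ) : (effect k).PosSemidef := by
  rw [effect_eq]
  exact posSemidef_vecMulVec_self_star _

lemma effect_apply (k : TwoQubit → ℂ) (x y : TwoQubit) : effect k x y = star (k x) * k y := rfl

lemma effect_smul (c : ℂ) (k : TwoQubit → ℂ) :
    effect (c • k) = ((‖c‖ ^ 2 : ℝ) : ℂ) • effect k := by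
  ext x y
  simp only [effect_apply, Pi.smul_apply, smul_eq_mul, Matrix.smul_apply, star_mul']
  push_cast
  rw [← Complex.conj_mul', ← RCLike.star_def]
  ring

lemma effect_mulVec (k v : TwoQubit → ℂ) : effect k *ᵥ v = (k ⬝ᵥ v) • star k := by
  ext x
  simp only [effect, mulVec, dotProduct, vecMulVec_apply, Pi.smul_apply, smul_eq_mul,
    Finset.sum_mul]
  exact Finset.sum_congr rfl fun y _ => by ring

lemma trace_effect_mul (k : TwoQubit → ℂ) (X : Op) :
    (effect k * X).trace = star (star k) ⬝ᵥ (X *ᵥ star k) := by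
  simp only [trace, diag_apply, Matrix.mul_apply, effect_apply, dotProduct, mulVec, star_star,
    Pi.star_apply, Finset.mul_sum]
  rw [Finset.sum_comm]
  exact Finset.sum_congr rfl fun x _ => Finset.sum_congr rfl fun y _ => by ring

lemma trace_effect (k : TwoQubit → ℂ) : (effect k).trace = ((∑ x, ‖k x‖ ^ 2 : ℝ) : ℂ) := by
  simp only [trace, diag_apply, effect_apply, RCLike.star_def, Complex.conj_mul']
  push_cast
  rfl

lemma trace_effect_re (k : TwoQubit → ℂ) : (effect k).trace.re = ∑ x, ‖k x‖ ^ 2 := by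
  rw [trace_effect, Complex.ofReal_re]

/-- In an eigenbasis of `A`, the vector `u` has components only at the eigenvalue `t`. -/
lemma quadForm_cfc_of_eigenvector {n : Type} [Fintype n] [DecidableEq n] {A : Matrix n n ℂ}
    (hA : A.IsHermitian) {u : n → ℂ} {t : ℝ} (hu : A *ᵥ u = (t : ℂ) • u) (f : ℝ → ℝ) :
    (star u ⬝ᵥ (cfc f A *ᵥ u)).re = f t * ∑ i, ‖u i‖ ^ 2 := by
  obtain ⟨V, d, hV, rfl⟩ := exists_conj_diagonal hA
  rw [cfc_conj_diagonal _ hV, quadForm_conj_diagonal, Complex.ofReal_re,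
    ← sum_normSq_conj_mulVec hV, Finset.mul_sum]
  refine Finset.sum_congr rfl fun i _ => ?_
  have h := congrFun (congrArg (Vᴴ *ᵥ ·) hu) i
  simp only [mulVec_mulVec, mulVec_smul, Pi.smul_apply, smul_eq_mul] at h
  rw [Matrix.mul_assoc V, ← Matrix.mul_assoc Vᴴ, hV, Matrix.one_mul, ← mulVec_mulVec,
    mulVec_diagonal] at h
  by_cases h0 : (Vᴴ *ᵥ u) i = 0
  · simp [h0]
  · have : d i = t := by exact_mod_cast mul_right_cancel₀ h0 h
    rw [this]

/-- The vector `star k` is an eigenvector of `effect k`, with the trace as eigenvalue. -/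
lemma trace_effect_mul_log (k : TwoQubit → ℂ) :
    (effect k * cfc Real.log (effect k)).trace.re = -Real.negMulLog (∑ x, ‖k x‖ ^ 2) := by
  have h : effect k *ᵥ star k = ((∑ x, ‖k x‖ ^ 2 : ℝ) : ℂ) • star k := by
    rw [effect_mulVec, ← trace_effect]
    congr 1
    simp [dotProduct, trace, effect_apply, mul_comm]
  rw [trace_effect_mul, quadForm_cfc_of_eigenvector (effect_posSemidef k).isHermitian h]
  simp [Real.negMulLog, mul_comm]

/-- Entropy of entanglement of an unnormalized bra in Schmidt form, in bits. -/
def schmidtEntropy (k : TwoQubit → ℂ) : ℝ :=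
  (∑ x, Real.negMulLog (‖k x‖ ^ 2) - Real.negMulLog (∑ x, ‖k x‖ ^ 2)) / Real.log 2

/-- The terms with `log ‖c‖²` cancel between the two parts of the entropy. This homogeneity absorbs
the factor `1/4` of Choi states and the normalization of outcomes. -/
lemma schmidtEntropy_smul (c : ℂ) (k : TwoQubit → ℂ) :
    schmidtEntropy (c • k) = ‖c‖ ^ 2 * schmidtEntropy k := by
  simp only [schmidtEntropy, Pi.smul_apply, smul_eq_mul, norm_mul, mul_pow, ← Finset.mul_sum,
    Real.negMulLog_mul, Finset.sum_add_distrib, ← Finset.sum_mul]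
  ring

/-- The Schmidt basis of the bra consists of computational basis vectors. -/
def InSchmidtForm (k : TwoQubit → ℂ) : Prop := ∃ c : Fin 2, ∀ x y, y ≠ x + c → k (x, y) = 0

lemma InSchmidtForm.smul {k : TwoQubit → ℂ} (h : InSchmidtForm k) (c : ℂ) :
    InSchmidtForm (c • k) := by
  obtain ⟨d, h⟩ := h
  exact ⟨d, fun x y hxy => by simp [h x y hxy]⟩

lemma InSchmidtForm.rows_orthogonal {k : TwoQubit → ℂ} (h : InSchmidtForm k) :
    ∑ y, star k (0, y) * star (star k (1, y)) = 0 := by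
  obtain ⟨c, h⟩ := h
  refine Finset.sum_eq_zero fun y _ => ?_
  by_cases h0 : y = 0 + c
  · have h1 : y ≠ 1 + c := by
      rw [h0]
      intro h2
      exact zero_ne_one (add_right_cancel h2)
    simp [h 1 y h1]
  · simp [h 0 y h0]

lemma InSchmidtForm.sum_rowWeight_log {k : TwoQubit → ℂ} (h : InSchmidtForm k) :
    ∑ x, rowWeight (star k) x * Real.log (rowWeight (star k) x) =
      -∑ x, Real.negMulLog (‖k x‖ ^ 2) := by
  obtain ⟨c, h⟩ := h
  rw [Fintype.sum_prod_type, ← Finset.sum_neg_distrib]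
  refine Finset.sum_congr rfl fun x _ => ?_
  rw [rowWeight, Finset.sum_eq_single (x + c) (fun y _ hy => by simp [h x y hy]) (by simp),
    Finset.sum_eq_single (x + c) (fun y _ hy => by simp [h x y hy]) (by simp)]
  simp [Real.negMulLog]

lemma sum_rowWeight (k : TwoQubit → ℂ) : ∑ x, rowWeight (star k) x = ∑ x, ‖k x‖ ^ 2 := by
  simp [rowWeight, Fintype.sum_prod_type]

lemma log_two_pos : 0 < Real.log 2 := Real.log_pos one_lt_two

/-- Lower bound for the relative entropy with respect to a separable operator. -/
lemma InSchmidtForm.le_relEntropy {k : TwoQubit → ℂ} (h : InSchmidtForm k) {B : Op}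
    (hB : IsSeparable B) :
    ((schmidtEntropy k + ((effect k).trace.re - B.trace.re) / Real.log 2 : ℝ) : EReal) ≤
      relEntropy (effect k) B := by
  unfold relEntropy
  split_ifs with hs
  · rw [EReal.coe_le_coe_iff, schmidtEntropy, ← add_div]
    refine div_le_div_of_nonneg_right ?_ log_two_pos.le
    rw [Matrix.mul_sub, trace_sub, Complex.sub_re, trace_effect_mul_log, trace_effect_mul]
    have hs' : ∀ v, B *ᵥ v = 0 → star (star k) ⬝ᵥ v = 0 := by
      intro v hv
      have := hs v hv
      rw [effect_mulVec, smul_eq_zero] at this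
      rw [star_star]
      rcases this with h1 | h1
      · exact h1
      · simp [star_eq_zero.mp h1]
    have := quadForm_log_separable_le hB h.rows_orthogonal hs'
    rw [h.sum_rowWeight_log, sum_rowWeight] at this
    rw [trace_effect_re]
    linarith
  · exact le_top

/-- The operator with the squared moduli of `k` on the diagonal. -/
def dephased (k : TwoQubit → ℂ) : Op := diagonal fun x => ((‖k x‖ ^ 2 : ℝ) : ℂ)

/-- The diagonal logarithm meets `effect k` only in the weights `‖k x‖²`, and `k` vanishes wherever
the diagonal does. No Schmidt form is needed; it matters only for optimality. -/
lemma relEntropy_dephased (k : TwoQubit → ℂ) :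
    relEntropy (effect k) (dephased k) = ((schmidtEntropy k : ℝ) : EReal) := by
  have hs : ∀ v, dephased k *ᵥ v = 0 → effect k *ᵥ v = 0 := by
    intro v hv
    have : k ⬝ᵥ v = 0 := by
      refine Finset.sum_eq_zero fun x _ => ?_
      have := congrFun hv x
      rw [dephased, mulVec_diagonal] at this
      simpa using this
    rw [effect_mulVec, this, zero_smul]
  rw [relEntropy, if_pos hs, EReal.coe_eq_coe_iff, schmidtEntropy]
  congr 1
  have hlog : cfc Real.log (dephased k) =
      1 * diagonal (fun x => ((Real.log (‖k x‖ ^ 2) : ℝ) : ℂ)) * (1 : Op)ᴴ := by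
    rw [← cfc_conj_diagonal _ (by simp), dephased]
    simp
  rw [Matrix.mul_sub, trace_sub, Complex.sub_re, trace_effect_mul_log, trace_effect_mul, hlog,
    quadForm_conj_diagonal, Complex.ofReal_re]
  simp only [Real.negMulLog, conjTranspose_one, one_mulVec, Pi.star_apply, norm_star]
  rw [Finset.sum_congr rfl fun x _ => neg_mul (‖k x‖ ^ 2) _, Finset.sum_neg_distrib,
    Finset.sum_congr rfl fun x _ => mul_comm (Real.log (‖k x‖ ^ 2)) _]
  ring

lemma isSeparable_dephased (k : TwoQubit → ℂ) : IsSeparable (dephased k) := by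
  have e := (Fintype.equivFin TwoQubit).symm
  refine ⟨Fintype.card TwoQubit,
    fun i => diagonal (Pi.single (e i).1 ((‖k (e i)‖ ^ 2 : ℝ) : ℂ)),
    fun i => diagonal (Pi.single (e i).2 1), fun i => ?_, fun i => ?_, ?_⟩
  · rw [posSemidef_diagonal_iff]
    exact Pi.le_def.mp (Pi.single_nonneg.mpr (Complex.zero_le_real.mpr (sq_nonneg _)))
  · rw [posSemidef_diagonal_iff]
    exact Pi.le_def.mp (Pi.single_nonneg.mpr zero_le_one)
  · rw [Equiv.sum_comp e (fun x => (diagonal (Pi.single x.1 ((‖k x‖ ^ 2 : ℝ) : ℂ)) :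
      Matrix (Fin 2) (Fin 2) ℂ) ⊗ₖ diagonal (Pi.single x.2 1))]
    simp only [diagonal_kronecker_diagonal, dephased]
    ext a b
    rw [Matrix.sum_apply]
    by_cases hab : a = b
    · subst hab
      simp only [diagonal_apply_eq]
      rw [Finset.sum_eq_single a]
      · simp
      · intro x _ hx
        by_cases h1 : a.1 = x.1
        · have h2 : a.2 ≠ x.2 := fun h2 => hx (Prod.ext h1 h2).symm
          simp [h2]
        · simp [h1]
      · simp
    · simp [diagonal_apply_ne _ hab]

lemma dephased_smul (c : ℂ) (k : TwoQubit → ℂ) :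
    dephased (c • k) = ((‖c‖ ^ 2 : ℝ) : ℂ) • dephased k := by
  rw [dephased, dephased, ← diagonal_smul]
  congr 1
  ext x
  simp [mul_pow]

lemma trace_dephased (k : TwoQubit → ℂ) : (dephased k).trace = (effect k).trace := by
  rw [trace_effect, dephased, trace_diagonal]
  push_cast
  rfl

lemma IsSeparable.smul {N : Op} (h : IsSeparable N) {c : ℝ} (hc : 0 ≤ c) :
    IsSeparable ((c : ℂ) • N) := by
  obtain ⟨r, A, B, hA, hB, rfl⟩ := h
  refine ⟨r, fun i => (c : ℂ) • A i, B, fun i => (hA i).smul (by exact_mod_cast hc), hB, ?_⟩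
  simp [Finset.smul_sum, smul_kronecker]

/-- The relative entropy of entanglement of a pure state in Schmidt form. -/
lemma InSchmidtForm.stateREE_eq {k : TwoQubit → ℂ} (h : InSchmidtForm k)
    (hk : (effect k).trace = 1) : stateREE (effect k) = ((schmidtEntropy k : ℝ) : EReal) := by
  apply le_antisymm
  · rw [← relEntropy_dephased]
    exact iInf₂_le _ ⟨isSeparable_dephased k, (trace_dephased k).trans hk⟩
  · refine le_iInf₂ fun σ hσ => ?_
    have := h.le_relEntropy hσ.1
    rwa [hk, hσ.2, sub_self, zero_div, add_zero] at this

lemma EReal_coe_sum {ι : Type} (s : Finset ι) (f : ι → ℝ) :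
    ((∑ i ∈ s, f i : ℝ) : EReal) = ∑ i ∈ s, (f i : EReal) := by
  classical
  induction s using Finset.induction_on with
  | empty => simp
  | insert a s ha ih => rw [Finset.sum_insert ha, Finset.sum_insert ha, EReal.coe_add, ih]

/-- The average relative entropy of entanglement of bras in Schmidt form. -/
lemma averageREE_eq {ι : Type} [Fintype ι] {K : BraFamily ι} (h : ∀ i, InSchmidtForm (K i)) :
    averageREE K = ((1 / 4 * ∑ i, schmidtEntropy (K i) : ℝ) : EReal) := by
  rw [averageREE, Finset.mul_sum, EReal_coe_sum]
  refine Finset.sum_congr rfl fun i _ => ?_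
  set t : ℝ := ∑ x, ‖K i x‖ ^ 2 with ht
  have ht0 : 0 ≤ t := Finset.sum_nonneg fun _ _ => by positivity
  have htr : (effect (K i)).trace = (t : ℂ) := trace_effect _
  rw [htr, Complex.ofReal_re]
  -- An outcome of weight zero, such as the third one of `bellKraus 1`, contributes nothing: in
  -- `EReal`, zero times any value is zero.
  rcases ht0.eq_or_lt with h0 | h0
  · have hK : K i = 0 := by
      ext x
      have := (Finset.sum_eq_zero_iff_of_nonneg (fun x _ => by positivity)).mp
        (ht.symm.trans h0.symm) x (Finset.mem_univ x)
      simpa using this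
    have : schmidtEntropy (K i) = 0 := by
      simp [schmidtEntropy, hK]
    rw [← h0, this]
    simp
  · set c : ℂ := (((√t)⁻¹ : ℝ) : ℂ) with hc
    have hc2 : ‖c‖ ^ 2 = t⁻¹ := by
      rw [hc, Complex.norm_real, Real.norm_eq_abs, sq_abs, inv_pow, Real.sq_sqrt h0.le]
    have heff : (t : ℂ)⁻¹ • effect (K i) = effect (c • K i) := by
      rw [effect_smul, hc2]
      push_cast
      rfl
    have htr1 : (effect (c • K i)).trace = 1 := by
      rw [← heff, trace_smul, htr, smul_eq_mul, inv_mul_cancel₀]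
      exact_mod_cast h0.ne'
    rw [heff, ((h i).smul c).stateREE_eq htr1, schmidtEntropy_smul, hc2, ← EReal.coe_mul]
    congr 1
    field_simp

/-- The relative entropy of entanglement of a measurement with bras in Schmidt form. -/
lemma measurementREE_eq {ι : Type} [Fintype ι] {K : BraFamily ι} (h : ∀ i, InSchmidtForm (K i))
    (hK : ∑ i, effect (K i) = 1) :
    measurementREE K = ((1 / 4 * ∑ i, schmidtEntropy (K i) : ℝ) : EReal) := by
  have hnorm : ‖(1 / 2 : ℂ)‖ ^ 2 = 1 / 4 := by norm_num
  -- The factor `1/4` of the Choi blocks becomes a factor `1/2` of the bras.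
  have hE : ∀ i, (1 / 4 : ℂ) • effect (K i) = effect ((1 / 2 : ℂ) • K i) := by
    intro i
    rw [effect_smul, hnorm]
    norm_num
  have hH : ∀ i, schmidtEntropy ((1 / 2 : ℂ) • K i) = 1 / 4 * schmidtEntropy (K i) := by
    intro i
    rw [schmidtEntropy_smul, hnorm]
  apply le_antisymm
  · have hsep : IsSeparableMeasurement fun i => dephased (K i) := by
      refine ⟨fun i => isSeparable_dephased _, ?_⟩
      ext x y
      have hxy := congrFun (congrFun hK x) y
      rw [Matrix.sum_apply] at hxy ⊢
      by_cases hne : x = y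
      · subst hne
        rw [← hxy]
        refine Finset.sum_congr rfl fun i _ => ?_
        rw [dephased, diagonal_apply_eq, effect_apply, RCLike.star_def, Complex.conj_mul']
        push_cast
        rfl
      · rw [one_apply_ne hne]
        exact Finset.sum_eq_zero fun i _ => diagonal_apply_ne _ hne
    · refine (iInf₂_le _ hsep).trans ?_
      rw [measurementRelEntropy, Finset.mul_sum, EReal_coe_sum]
      refine Finset.sum_le_sum fun i _ => ?_
      have hd : (1 / 4 : ℂ) • dephased (K i) = dephased ((1 / 2 : ℂ) • K i) := by
        rw [dephased_smul, hnorm]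
        norm_num
      rw [hE, hd, relEntropy_dephased, hH]
  · refine le_iInf₂ fun N hN => ?_
    -- Single outcomes of `N` may have traces different from those of `K`, so the trace difference
    -- is kept. It vanishes only after summation, as both families sum to the identity.
    have key : ∀ i, ((1 / 4 * schmidtEntropy (K i) +
        1 / 4 * ((effect (K i)).trace.re - (N i).trace.re) / Real.log 2 : ℝ) : EReal) ≤
        relEntropy ((1 / 4 : ℂ) • effect (K i)) ((1 / 4 : ℂ) • N i) := by
      intro i
      have hsep : IsSeparable ((1 / 4 : ℂ) • N i) := by
        have := (hN.1 i).smul (c := 1 / 4) (by norm_num)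
        push_cast at this
        exact this
      have := ((h i).smul (1 / 2)).le_relEntropy hsep
      rw [hH, ← hE] at this
      refine le_trans (le_of_eq ?_) this
      congr 2
      simp only [trace_smul, smul_eq_mul, Complex.mul_re]
      norm_num
      ring
    have hsum : ∑ i, (1 / 4 * schmidtEntropy (K i) +
        1 / 4 * ((effect (K i)).trace.re - (N i).trace.re) / Real.log 2) =
        1 / 4 * ∑ i, schmidtEntropy (K i) := by
      rw [Finset.sum_add_distrib, ← Finset.sum_div, ← Finset.mul_sum, ← Finset.mul_sum,
        Finset.sum_sub_distrib, ← Complex.re_sum, ← Complex.re_sum, ← trace_sum, ← trace_sum, hK,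
        hN.2]
      simp
    rw [← hsum, EReal_coe_sum]
    exact Finset.sum_le_sum fun i _ => key i

/-! ### Moments of the symmetric binomial distribution -/

section Binomial

/-- Binomial weights are Bernstein polynomials at `1/2`, so known identities for these give total
mass, mean and variance below, and later the limit of the entropy. -/
lemma eval_half_bernsteinPolynomial {m k : ℕ} (hk : k ∈ Finset.range (m + 1)) :
    (bernsteinPolynomial ℝ m k).eval (1 / 2) = m.choose k / 2 ^ m := by
  have hk : k ≤ m := Nat.lt_succ_iff.mp (Finset.mem_range.mp hk)
  have h : (2 : ℝ) ^ m = 2 ^ k * 2 ^ (m - k) := by rw [← pow_add, Nat.add_sub_cancel' hk]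
  rw [bernsteinPolynomial, h]
  simp only [Polynomial.eval_mul, Polynomial.eval_natCast, Polynomial.eval_pow, Polynomial.eval_X,
    Polynomial.eval_sub, Polynomial.eval_one]
  rw [sub_half, one_div, inv_pow, inv_pow]
  field_simp

lemma sum_choose_div (m : ℕ) :
    ∑ k ∈ Finset.range (m + 1), (m.choose k : ℝ) / 2 ^ m = 1 := by
  have h := congrArg (Polynomial.eval (1 / 2 : ℝ)) (bernsteinPolynomial.sum ℝ m)
  rw [Polynomial.eval_finsetSum, Finset.sum_congr rfl fun k hk => eval_half_bernsteinPolynomial hk]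
    at h
  simpa using h

lemma sum_choose_div_mul (m : ℕ) :
    ∑ k ∈ Finset.range (m + 1), (m.choose k : ℝ) / 2 ^ m * (m - 2 * k) = 0 := by
  have h := congrArg (Polynomial.eval (1 / 2 : ℝ)) (bernsteinPolynomial.sum_smul ℝ m)
  rw [Polynomial.eval_finsetSum] at h
  simp only [nsmul_eq_mul, Polynomial.eval_mul, Polynomial.eval_natCast, Polynomial.eval_X] at h
  rw [Finset.sum_congr rfl fun k hk => by rw [eval_half_bernsteinPolynomial hk]] at h
  have h2 : ∑ k ∈ Finset.range (m + 1), (m.choose k : ℝ) / 2 ^ m * (m - 2 * k) =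
      m * ∑ k ∈ Finset.range (m + 1), (m.choose k : ℝ) / 2 ^ m -
      2 * ∑ k ∈ Finset.range (m + 1), (k : ℝ) * (m.choose k / 2 ^ m) := by
    rw [Finset.mul_sum, Finset.mul_sum, ← Finset.sum_sub_distrib]
    exact Finset.sum_congr rfl fun k _ => by ring
  rw [h2, sum_choose_div, h]
  ring

lemma sum_choose_div_mul_sq (m : ℕ) :
    ∑ k ∈ Finset.range (m + 1), (m.choose k : ℝ) / 2 ^ m * ((m : ℝ) - 2 * k) ^ 2 = (m : ℝ) := by
  have h := congrArg (Polynomial.eval (1 / 2 : ℝ)) (bernsteinPolynomial.variance ℝ m)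
  rw [Polynomial.eval_finsetSum] at h
  simp only [Polynomial.eval_mul, Polynomial.eval_pow, Polynomial.eval_sub,
    nsmul_eq_mul, Polynomial.eval_X, Polynomial.eval_natCast, Polynomial.eval_one] at h
  rw [Finset.sum_congr rfl fun k hk => by rw [eval_half_bernsteinPolynomial hk]] at h
  have h2 : ∑ k ∈ Finset.range (m + 1), (m.choose k : ℝ) / 2 ^ m * ((m : ℝ) - 2 * k) ^ 2 =
      4 * ∑ k ∈ Finset.range (m + 1), ((m : ℝ) * (1 / 2) - k) ^ 2 * (m.choose k / 2 ^ m) := by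
    rw [Finset.mul_sum]
    exact Finset.sum_congr rfl fun k _ => by ring
  rw [h2, h]
  ring

end Binomial

/-! ### Schmidt entropies and completeness of the Kraus operators -/

lemma ofReals_apply (c : Fin 2 → Fin 2 → ℝ) (x y : Fin 2) : ofReals c (x, y) = (c x y : ℂ) := rfl

lemma smul_ofReals (a : ℝ) (c : Fin 2 → Fin 2 → ℝ) :
    (a : ℂ) • ofReals c = ofReals (a • c) := by
  ext ⟨x, y⟩
  simp [ofReals]

lemma inSchmidtForm_diag (a b : ℝ) : InSchmidtForm (ofReals ![![a, 0], ![0, b]]) := by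
  refine ⟨0, fun x y hxy => ?_⟩
  fin_cases x <;> fin_cases y <;> simp_all [ofReals]

lemma inSchmidtForm_antidiag (a b : ℝ) : InSchmidtForm (ofReals ![![0, a], ![b, 0]]) := by
  refine ⟨1, fun x y hxy => ?_⟩
  fin_cases x <;> fin_cases y <;> simp_all [ofReals]

lemma schmidtEntropy_diag (a b : ℝ) : schmidtEntropy (ofReals ![![a, 0], ![0, b]]) =
    (Real.negMulLog (a ^ 2) + Real.negMulLog (b ^ 2) - Real.negMulLog (a ^ 2 + b ^ 2)) /
      Real.log 2 := by
  simp [schmidtEntropy, Fintype.sum_prod_type, ofReals]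

lemma schmidtEntropy_antidiag (a b : ℝ) : schmidtEntropy (ofReals ![![0, a], ![b, 0]]) =
    (Real.negMulLog (a ^ 2) + Real.negMulLog (b ^ 2) - Real.negMulLog (a ^ 2 + b ^ 2)) /
      Real.log 2 := by
  simp [schmidtEntropy, Fintype.sum_prod_type, ofReals]

lemma one_div_sqrt_two_sq : (1 / √2 : ℝ) ^ 2 = 1 / 2 := by
  rw [div_pow, Real.sq_sqrt zero_le_two, one_pow]

lemma negMulLog_half : Real.negMulLog (1 / 2) = Real.log 2 / 2 := by
  rw [Real.negMulLog, one_div, Real.log_inv]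
  ring

lemma schmidtEntropy_bell (b : Fin 4) : schmidtEntropy (bell b) = 1 := by
  have hl := log_two_pos.ne'
  have h : (1 / 2 : ℝ) + 1 / 2 = 1 := by norm_num
  fin_cases b
  · simp only [bell, psiPlus, schmidtEntropy_antidiag, one_div_sqrt_two_sq, negMulLog_half, h,
      Fin.zero_eta, cons_val_zero, Real.negMulLog_one]
    field_simp
    ring
  · simp only [bell, psiMinus, schmidtEntropy_antidiag, one_div_sqrt_two_sq, negMulLog_half, h,
      Fin.mk_one, cons_val_one, cons_val_zero, Real.negMulLog_one, neg_sq]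
    field_simp
    ring
  · simp only [bell, phiPlus, schmidtEntropy_diag, one_div_sqrt_two_sq, negMulLog_half, h,
      Fin.reduceFinMk, cons_val, Real.negMulLog_one]
    field_simp
    ring
  · simp only [bell, phiMinus, schmidtEntropy_diag, one_div_sqrt_two_sq, negMulLog_half, h,
      Fin.reduceFinMk, cons_val, Real.negMulLog_one, neg_sq]
    field_simp
    ring

/-- Matches `F` with the Schmidt entropy of the coefficients `x` and `1 - x`, in a form that is
visibly continuous. -/
lemma F_eq (x : ℝ) : F x = (Real.negMulLog (x ^ 2) + Real.negMulLog ((1 - x) ^ 2) -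
    Real.negMulLog (x ^ 2 + (1 - x) ^ 2)) / Real.log 2 := by
  -- Twice this sum is `(2 * x - 1) ^ 2 + 1`.
  have hs : x ^ 2 + (1 - x) ^ 2 ≠ 0 := by nlinarith [sq_nonneg (2 * x - 1)]
  have h : ∀ p : ℝ, entropyTerm x p =
      (Real.negMulLog (p ^ 2) + p ^ 2 * Real.log (x ^ 2 + (1 - x) ^ 2)) / Real.log 2 := by
    intro p
    by_cases hp : p = 0
    · simp [entropyTerm, hp]
    · rw [entropyTerm, Real.logb, Real.log_div (pow_ne_zero 2 hp) hs, Real.negMulLog]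
      ring
  rw [F, h, h, Real.negMulLog.eq_1 (x ^ 2 + _)]
  ring

/-- With `y = k / m` this brings `K_k` to Schmidt form. The factor `√2` accounts for `2 ^ (m - 1)`
instead of `2 ^ m` in the entropy formula. -/
lemma phi_combination (y : ℝ) :
    phiMinus + ((1 - 2 * y : ℝ) : ℂ) • phiPlus =
      ((√2 : ℝ) : ℂ) • ofReals ![![1 - y, 0], ![0, -y]] := by
  have h : (√2 : ℝ) ≠ 0 := by positivity
  rw [phiMinus, phiPlus, smul_ofReals, smul_ofReals]
  ext ⟨i, j⟩
  simp only [Pi.add_apply, ofReals_apply]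
  rw [← Complex.ofReal_add, Complex.ofReal_inj]
  fin_cases i <;> fin_cases j <;> simp <;> field_simp <;>
    rw [Real.sq_sqrt zero_le_two] <;> ring

lemma inSchmidtForm_bellKraus (m : ℕ) (i : Outcome m) : InSchmidtForm (bellKraus m i) := by
  rcases i with i | k
  · fin_cases i
    · exact inSchmidtForm_antidiag _ _
    · exact inSchmidtForm_antidiag _ _
    · exact (inSchmidtForm_diag _ _).smul _
  · refine InSchmidtForm.smul ⟨0, fun x y hxy => ?_⟩ _
    fin_cases x <;> fin_cases y <;> simp_all [ofReals, phiMinus, phiPlus]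

lemma bellKraus_inr {m : ℕ} (hm : 1 ≤ m) (k : Fin (m + 1)) :
    bellKraus m (Sum.inr k) = ((√(m.choose k) / √(2 ^ m) * √2 : ℝ) : ℂ) •
      ofReals ![![1 - (k : ℕ) / m, 0], ![0, -((k : ℕ) / m)]] := by
  have hm' : (m : ℝ) ≠ 0 := by positivity
  have h : ((m : ℝ) - 2 * (k : ℕ)) / m = 1 - 2 * ((k : ℕ) / m) := by field_simp
  simp only [bellKraus, Sum.elim_inr]
  rw [h, phi_combination, smul_smul, Complex.ofReal_mul]

lemma norm_sq_sqrt_div (m k : ℕ) :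
    ‖((√(m.choose k) / √(2 ^ m) : ℝ) : ℂ)‖ ^ 2 = m.choose k / 2 ^ m := by
  rw [Complex.norm_real, Real.norm_eq_abs, sq_abs, div_pow, Real.sq_sqrt (by positivity),
    Real.sq_sqrt (by positivity)]

lemma norm_sq_sqrt_one_sub {m : ℕ} (hm : 1 ≤ m) :
    ‖((√(1 - 1 / (m : ℝ)) : ℝ) : ℂ)‖ ^ 2 = 1 - 1 / m := by
  have : 1 / (m : ℝ) ≤ 1 := by
    rw [div_le_one (by positivity)]
    exact_mod_cast hm
  rw [Complex.norm_real, Real.norm_eq_abs, sq_abs, Real.sq_sqrt (by linarith)]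

lemma sum_schmidtEntropy_bellKraus {m : ℕ} (hm : 1 ≤ m) :
    1 / 4 * ∑ i, schmidtEntropy (bellKraus m i) = entanglementValue m := by
  have h1 : ∀ k : Fin (m + 1), schmidtEntropy (bellKraus m (Sum.inr k)) =
      (m.choose k : ℝ) * (1 / 2 ^ (m - 1)) * F ((k : ℕ) / m) := by
    intro k
    rw [bellKraus_inr hm, schmidtEntropy_smul, schmidtEntropy_diag, F_eq, Complex.ofReal_mul,
      norm_mul, mul_pow, norm_sq_sqrt_div, Complex.norm_real, Real.norm_eq_abs, sq_abs,
      Real.sq_sqrt zero_le_two, neg_sq, add_comm (Real.negMulLog ((1 - _) ^ 2)),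
      add_comm ((1 - _ : ℝ) ^ 2)]
    congr 1
    obtain ⟨n, rfl⟩ := Nat.exists_eq_add_of_le' hm
    rw [Nat.add_sub_cancel, pow_succ]
    field_simp
  rw [Fintype.sum_sum_type, Fin.sum_univ_three, Finset.sum_congr rfl fun k _ => h1 k,
    Fin.sum_univ_eq_sum_range (fun k => (m.choose k : ℝ) * (1 / 2 ^ (m - 1)) * F ((k : ℝ) / m)),
    entanglementValue]
  have e0 : schmidtEntropy (bellKraus m (Sum.inl 0)) = 1 := schmidtEntropy_bell 0
  have e1 : schmidtEntropy (bellKraus m (Sum.inl 1)) = 1 := schmidtEntropy_bell 1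
  have e2 : schmidtEntropy (bellKraus m (Sum.inl 2)) = 1 - 1 / m := by
    change schmidtEntropy (((√(1 - 1 / (m : ℝ)) : ℝ) : ℂ) • phiPlus) = _
    rw [schmidtEntropy_smul, norm_sq_sqrt_one_sub hm,
      show schmidtEntropy phiPlus = 1 from schmidtEntropy_bell 2, mul_one]
  rw [e0, e1, e2]
  ring

/-- Mixed products `|u⟩⟨v|` of two bras. -/
lemma effect_add_real_smul (k l : TwoQubit → ℂ) (x : ℝ) :
    effect (k + (x : ℂ) • l) = effect k +
      (x : ℂ) • (vecMulVec (star k) l + vecMulVec (star l) k) + ((x ^ 2 : ℝ) : ℂ) • effect l := by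
  ext i j
  simp [effect, vecMulVec_apply]
  ring

lemma sum_effect_bell : ∑ b, effect (bell b) = 1 := by
  have h : ((√2 : ℝ) : ℂ) * ((√2 : ℝ) : ℂ) = 2 := by
    rw [← Complex.ofReal_mul, Real.mul_self_sqrt zero_le_two]
    norm_num
  have h0 : ((√2 : ℝ) : ℂ) ≠ 0 := by
    intro h0
    rw [h0] at h
    norm_num at h
  ext ⟨x, y⟩ ⟨x', y'⟩
  rw [Matrix.sum_apply]
  fin_cases x <;> fin_cases y <;> fin_cases x' <;> fin_cases y' <;>
    simp [Fin.sum_univ_four, effect_apply, bell, psiPlus, psiMinus, phiPlus, phiMinus, ofReals]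
      <;> field_simp <;> simp [pow_two, h] <;> norm_num

/-- Of the expanded effects of the `K_k`, total mass one yields the full `φ⁻` term, mean zero
cancels the cross terms, and variance `m` yields `1/m` of the `φ⁺` term, which the third bra
completes. -/
lemma sum_effect_bellKraus {m : ℕ} (hm : 1 ≤ m) : ∑ i, effect (bellKraus m i) = 1 := by
  have hm' : (m : ℝ) ≠ 0 := by positivity
  have hk : ∀ k : Fin (m + 1), effect (bellKraus m (Sum.inr k)) =
      (((m.choose k : ℝ) / 2 ^ m : ℝ) : ℂ) • effect phiMinus +
      (((m.choose k : ℝ) / 2 ^ m * ((m : ℝ) - 2 * (k : ℕ)) : ℝ) : ℂ) • (((1 / m : ℝ) : ℂ) •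
        (vecMulVec (star phiMinus) phiPlus + vecMulVec (star phiPlus) phiMinus)) +
      (((m.choose k : ℝ) / 2 ^ m * ((m : ℝ) - 2 * (k : ℕ)) ^ 2 : ℝ) : ℂ) •
        (((1 / m ^ 2 : ℝ) : ℂ) • effect phiPlus) := by
    intro k
    simp only [bellKraus, Sum.elim_inr]
    rw [effect_smul, norm_sq_sqrt_div, effect_add_real_smul]
    push_cast
    rw [div_pow, div_eq_mul_one_div ((m : ℂ) - _), div_eq_mul_one_div (((m : ℂ) - _) ^ 2)]
    module
  rw [Fintype.sum_sum_type, Fin.sum_univ_three, Finset.sum_congr rfl fun k _ => hk k,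
    Finset.sum_add_distrib, Finset.sum_add_distrib, ← Finset.sum_smul, ← Finset.sum_smul,
    ← Finset.sum_smul, ← Complex.ofReal_sum, ← Complex.ofReal_sum, ← Complex.ofReal_sum,
    Fin.sum_univ_eq_sum_range (fun k => (m.choose k : ℝ) / 2 ^ m),
    Fin.sum_univ_eq_sum_range (fun k => (m.choose k : ℝ) / 2 ^ m * ((m : ℝ) - 2 * k)),
    Fin.sum_univ_eq_sum_range (fun k => (m.choose k : ℝ) / 2 ^ m * ((m : ℝ) - 2 * k) ^ 2),
    sum_choose_div, sum_choose_div_mul, sum_choose_div_mul_sq, ← sum_effect_bell,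
    Fin.sum_univ_four]
  have e2 : effect (bellKraus m (Sum.inl 2)) = ((1 - 1 / m : ℝ) : ℂ) • effect phiPlus := by
    change effect (((√(1 - 1 / (m : ℝ)) : ℝ) : ℂ) • phiPlus) = _
    rw [effect_smul, norm_sq_sqrt_one_sub hm]
  have e3 : ((m : ℝ) : ℂ) * ((1 / m ^ 2 : ℝ) : ℂ) = ((1 / m : ℝ) : ℂ) := by
    rw [← Complex.ofReal_mul]
    congr 1
    field_simp
  rw [e2, smul_smul ((m : ℝ) : ℂ), e3]
  change effect psiPlus + effect psiMinus + _ + _ =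
    effect psiPlus + effect psiMinus + effect phiPlus + effect phiMinus
  push_cast
  rw [one_smul, zero_smul, sub_smul, one_smul]
  abel

/-- The relative entropy of entanglement of the measurement. -/
lemma measurementREE_bellKraus {m : ℕ} (hm : 1 ≤ m) :
    measurementREE (bellKraus m) = ((entanglementValue m : ℝ) : EReal) := by
  rw [measurementREE_eq (inSchmidtForm_bellKraus m) (sum_effect_bellKraus hm),
    sum_schmidtEntropy_bellKraus hm]

lemma averageREE_bellKraus {m : ℕ} (hm : 1 ≤ m) :
    averageREE (bellKraus m) = ((entanglementValue m : ℝ) : EReal) := by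
  rw [averageREE_eq (inSchmidtForm_bellKraus m), sum_schmidtEntropy_bellKraus hm]

/-! ### Bell-state discrimination -/

lemma applyBra_add (k l v : TwoQubit → ℂ) : applyBra (k + l) v = applyBra k v + applyBra l v := by
  simp [applyBra, add_mul, Finset.sum_add_distrib]

lemma applyBra_smul (c : ℂ) (k v : TwoQubit → ℂ) : applyBra (c • k) v = c * applyBra k v := by
  simp [applyBra, Finset.mul_sum, mul_assoc]

lemma applyBra_bell (a b : Fin 4) : applyBra (bell a) (bell b) = if a = b then 1 else 0 := by
  have h : ((√2 : ℝ) : ℂ)⁻¹ * ((√2 : ℝ) : ℂ)⁻¹ = 1 / 2 := by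
    rw [← mul_inv, ← Complex.ofReal_mul, Real.mul_self_sqrt zero_le_two]
    norm_num
  fin_cases a <;> fin_cases b <;>
    simp [applyBra, Fintype.sum_prod_type, bell, psiPlus, psiMinus, phiPlus, phiMinus, ofReals, h]
      <;> norm_num

open Classical in
/-- Contribution of one outcome to the success probability. -/
def outcomeSuccess (k : TwoQubit → ℂ) : ℝ :=
  ∑ b, if Identifies k b then ‖applyBra k (bell b)‖ ^ 2 else 0

lemma successProb_eq_sum {ι : Type} [Fintype ι] (K : BraFamily ι) :
    successProb K = 1 / 4 * ∑ i, outcomeSuccess (K i) := by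
  rw [successProb, Finset.sum_comm]
  rfl

lemma outcomeSuccess_smul_bell (c : ℂ) (a : Fin 4) :
    outcomeSuccess (c • bell a) = ‖c‖ ^ 2 := by
  rw [outcomeSuccess, Finset.sum_eq_single a]
  · rw [if_pos]
    · simp [applyBra_smul, applyBra_bell]
    · intro b hb
      simp [applyBra_smul, applyBra_bell, hb.symm]
  · intro b _ hb
    simp [applyBra_smul, applyBra_bell, hb.symm]
  · simp

lemma outcomeSuccess_combination {c x : ℂ} (hc : c ≠ 0) (hx : x ≠ 0) :
    outcomeSuccess (c • (phiMinus + x • phiPlus)) = 0 := by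
  change outcomeSuccess (c • (bell 3 + x • bell 2)) = 0
  refine Finset.sum_eq_zero fun b _ => if_neg fun hb => ?_
  by_cases h : b = 3
  · subst h
    have := hb 2 (by decide)
    simp [applyBra_smul, applyBra_add, applyBra_bell, hc, hx] at this
  · have := hb 3 (Ne.symm h)
    simp [applyBra_smul, applyBra_add, applyBra_bell, hc] at this

/-- The probability of the outcome that identifies `φ⁻`. -/
def centralWeight (m : ℕ) : ℝ := if Even m then (m.choose (m / 2) : ℝ) / 2 ^ m else 0

/-- `K_k` identifies a Bell state only if its `φ⁺` component vanishes, that is, if `2 * k = m`. -/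
lemma successProb_bellKraus {m : ℕ} (hm : 1 ≤ m) :
    successProb (bellKraus m) = 1 / 4 * (3 - 1 / (m : ℝ) + centralWeight m) := by
  have hm' : (m : ℝ) ≠ 0 := by positivity
  have h0 : outcomeSuccess (bellKraus m (Sum.inl 0)) = 1 := by
    have := outcomeSuccess_smul_bell 1 0
    rw [one_smul, norm_one, one_pow] at this
    exact this
  have h1 : outcomeSuccess (bellKraus m (Sum.inl 1)) = 1 := by
    have := outcomeSuccess_smul_bell 1 1
    rw [one_smul, norm_one, one_pow] at this
    exact this
  have h2 : outcomeSuccess (bellKraus m (Sum.inl 2)) = 1 - 1 / m := by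
    rw [← norm_sq_sqrt_one_sub hm]
    exact outcomeSuccess_smul_bell _ 2
  have hk : ∀ k : Fin (m + 1), outcomeSuccess (bellKraus m (Sum.inr k)) =
      if 2 * (k : ℕ) = m then (m.choose k : ℝ) / 2 ^ m else 0 := by
    intro k
    simp only [bellKraus, Sum.elim_inr]
    split_ifs with h
    · have hx : ((((m : ℝ) - 2 * (k : ℕ)) / m : ℝ) : ℂ) = 0 := by
        have : (m : ℝ) = 2 * (k : ℕ) := by exact_mod_cast h.symm
        rw [← this]
        simp
      rw [hx, zero_smul, add_zero, ← norm_sq_sqrt_div]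
      exact outcomeSuccess_smul_bell _ 3
    · apply outcomeSuccess_combination
      · have : 0 < m.choose k := Nat.choose_pos (Nat.lt_succ_iff.mp k.2)
        have : (0 : ℝ) < √(m.choose k) / √(2 ^ m) := by positivity
        exact_mod_cast this.ne'
      · rw [Complex.ofReal_ne_zero]
        refine div_ne_zero (fun h0 => h ?_) hm'
        have : 2 * ((k : ℕ) : ℝ) = m := by linarith
        exact_mod_cast this
  have hs : ∑ k : Fin (m + 1), (if 2 * (k : ℕ) = m then (m.choose k : ℝ) / 2 ^ m else 0) =
      centralWeight m := by
    rw [Fin.sum_univ_eq_sum_range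
      (fun k => if 2 * k = m then (m.choose k : ℝ) / 2 ^ m else 0), centralWeight]
    split_ifs with he
    · obtain ⟨n, rfl⟩ := he
      have hn : (n + n) / 2 = n := by omega
      rw [hn, Finset.sum_eq_single n]
      · rw [if_pos (by omega)]
      · intro k _ hk
        exact if_neg (by omega)
      · intro h
        exact absurd (Finset.mem_range.mpr (by omega)) h
    · refine Finset.sum_eq_zero fun k _ => if_neg fun h => he ⟨k, by omega⟩
  rw [successProb_eq_sum, Fintype.sum_sum_type, Fin.sum_univ_three, h0, h1, h2,
    Finset.sum_congr rfl fun k _ => hk k, hs]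
  ring

lemma centralWeight_two_mul (n : ℕ) :
    centralWeight (2 * n) = (Nat.centralBinom n : ℝ) / 4 ^ n := by
  rw [centralWeight, if_pos (even_two_mul n), Nat.centralBinom, Nat.mul_div_cancel_left _ two_pos,
    pow_mul]
  norm_num

lemma centralWeight_succ (n : ℕ) :
    centralWeight (2 * (n + 1)) = centralWeight (2 * n) * ((2 * n + 1) / (2 * n + 2)) := by
  rw [centralWeight_two_mul, centralWeight_two_mul]
  have h := Nat.succ_mul_centralBinom_succ n
  have h' : ((n : ℝ) + 1) * Nat.centralBinom (n + 1) = 2 * (2 * n + 1) * Nat.centralBinom n := by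
    exact_mod_cast h
  rw [pow_succ]
  field_simp
  linear_combination 2 * h'

lemma centralWeight_nonneg (m : ℕ) : 0 ≤ centralWeight m := by
  unfold centralWeight
  split_ifs <;> positivity

lemma centralWeight_antitone : Antitone fun n => centralWeight (2 * n) := by
  refine antitone_nat_of_succ_le fun n => ?_
  rw [centralWeight_succ]
  refine mul_le_of_le_one_right (centralWeight_nonneg _) ?_
  rw [div_le_one (by positivity)]
  linarith

/-- The left side does not increase with `n`, because `(2n + 1)(2n + 3) ≤ (2n + 2)²`. -/
lemma centralWeight_sq_le (n : ℕ) : centralWeight (2 * n) ^ 2 * (2 * n + 1) ≤ 1 := by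
  induction n with
  | zero => simp [centralWeight]
  | succ n ih =>
    rw [centralWeight_succ]
    push_cast
    refine le_trans ?_ ih
    have h : (((2 : ℝ) * n + 1) / (2 * n + 2)) ^ 2 * (2 * (n + 1) + 1) ≤ 2 * n + 1 := by
      rw [div_pow, div_mul_eq_mul_div, div_le_iff₀ (by positivity)]
      nlinarith [(n.cast_nonneg : (0 : ℝ) ≤ n)]
    calc _ = centralWeight (2 * n) ^ 2 *
          ((((2 : ℝ) * n + 1) / (2 * n + 2)) ^ 2 * (2 * (n + 1) + 1)) := by ring
      _ ≤ _ := mul_le_mul_of_nonneg_left h (by positivity)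

lemma centralWeight_le (m : ℕ) : centralWeight m ≤ √(1 / ((m : ℝ) + 1)) := by
  by_cases he : Even m
  · obtain ⟨n, rfl⟩ := he
    rw [← two_mul]
    apply Real.le_sqrt_of_sq_le
    rw [le_div_iff₀ (by positivity)]
    have := centralWeight_sq_le n
    push_cast
    exact this
  · rw [centralWeight, if_neg he]
    positivity

lemma tendsto_centralWeight : Filter.Tendsto centralWeight Filter.atTop (nhds 0) := by
  refine squeeze_zero centralWeight_nonneg centralWeight_le ?_
  have := (tendsto_one_div_add_atTop_nhds_zero_nat (𝕜 := ℝ)).sqrt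
  rwa [Real.sqrt_zero] at this

lemma tendsto_one_div_nat : Filter.Tendsto (fun m : ℕ => 1 / (m : ℝ)) Filter.atTop (nhds 0) :=
  tendsto_one_div_atTop_nhds_zero_nat

lemma tendsto_successProb :
    Filter.Tendsto (fun m : ℕ => successProb (bellKraus m)) Filter.atTop (nhds (3 / 4)) := by
  have h : Filter.Tendsto (fun m : ℕ => 1 / 4 * (3 - 1 / (m : ℝ) + centralWeight m))
      Filter.atTop (nhds (1 / 4 * (3 - 0 + 0))) :=
    ((tendsto_const_nhds.sub tendsto_one_div_nat).add tendsto_centralWeight).const_mul _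
  have e : (1 / 4 * (3 - 0 + 0) : ℝ) = 3 / 4 := by norm_num
  rw [e] at h
  refine h.congr' ?_
  filter_upwards [Filter.eventually_ge_atTop 1] with m hm
  rw [successProb_bellKraus hm]

/-- The constant is the value at `n = 4`, that is, `m = 8`: `70/256 - 1/8 = 19/128`. -/
lemma centralWeight_sub_le {n : ℕ} (hn : 1 ≤ n) :
    centralWeight (2 * n) - 1 / ((2 * n : ℕ) : ℝ) ≤ 19 / 128 := by
  -- At `n = 16` the central weight alone is below the bound. By monotonicity this settles all
  -- larger `n`.
  have key : ∀ n : ℕ, 1 ≤ n → n ≤ 16 →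
      centralWeight (2 * n) - (if n = 16 then 0 else 1 / ((2 * n : ℕ) : ℝ)) ≤ 19 / 128 := by
    intro n h1 h2
    rw [centralWeight_two_mul, Nat.centralBinom]
    interval_cases n <;> norm_num [Nat.choose]
  rcases lt_or_ge n 16 with h | h
  · have := key n hn h.le
    rwa [if_neg h.ne] at this
  · have h1 := key 16 (by norm_num) le_rfl
    have h2 : centralWeight (2 * n) ≤ centralWeight (2 * 16) := centralWeight_antitone h
    have h3 : (0 : ℝ) ≤ 1 / ((2 * n : ℕ) : ℝ) := by positivity
    rw [if_pos rfl] at h1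
    linarith

lemma successProb_eight : successProb (bellKraus 8) = 403 / 512 := by
  rw [successProb_bellKraus (by norm_num), show 8 = 2 * 4 from rfl, centralWeight_two_mul,
    Nat.centralBinom]
  norm_num [Nat.choose]

/-- For odd `m` the value stays below `3/4`, so only even `m` compete. -/
lemma successProb_le {m : ℕ} (hm : 1 ≤ m) : successProb (bellKraus m) ≤ 403 / 512 := by
  rw [successProb_bellKraus hm]
  by_cases he : Even m
  · obtain ⟨n, rfl⟩ := he
    rw [← two_mul] at hm ⊢
    have := centralWeight_sub_le (n := n) (by omega)
    linarith
  · have : (0 : ℝ) ≤ 1 / (m : ℝ) := by positivity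
    rw [centralWeight, if_neg he]
    linarith

/-! ### The limit of the relative entropy of entanglement -/

lemma continuous_F : Continuous F := by
  have : F = fun x => (Real.negMulLog (x ^ 2) + Real.negMulLog ((1 - x) ^ 2) -
      Real.negMulLog (x ^ 2 + (1 - x) ^ 2)) / Real.log 2 := funext F_eq
  rw [this]
  have := Real.continuous_negMulLog
  fun_prop

lemma F_half : F (1 / 2) = 1 / 2 := by
  have h4 : Real.negMulLog (1 / 4) = Real.log 2 / 2 := by
    rw [Real.negMulLog, one_div, Real.log_inv, show (4 : ℝ) = 2 ^ 2 by norm_num, Real.log_pow]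
    push_cast
    ring
  have hl := log_two_pos.ne'
  rw [F_eq, show ((1 : ℝ) / 2) ^ 2 = 1 / 4 by norm_num, show (1 - (1 : ℝ) / 2) ^ 2 = 1 / 4 by
    norm_num, show (1 : ℝ) / 4 + 1 / 4 = 1 / 2 by norm_num, h4, negMulLog_half]
  field_simp
  norm_num

/-- The binomial sum is twice the Bernstein approximation of `F` at `1/2`, hence tends to `2 * F
(1/2) = 1`. -/
lemma tendsto_entanglementValue :
    Filter.Tendsto entanglementValue Filter.atTop (nhds 1) := by
  set f : C(unitInterval, ℝ) := ⟨fun x => F x, continuous_F.comp continuous_subtype_val⟩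
  have hf := (bernsteinApproximation_uniform f)
  set x₀ : unitInterval := ⟨1 / 2, by norm_num, by norm_num⟩
  have h1 : Filter.Tendsto (fun n => bernsteinApproximation n f x₀) Filter.atTop
      (nhds (1 / 2)) := by
    have := ((continuous_eval_const x₀).tendsto f).comp hf
    have e : f x₀ = 1 / 2 := F_half
    rw [e] at this
    exact this
  have h2 : ∀ m : ℕ, 1 ≤ m → 1 / 4 * (3 - 1 / (m : ℝ) + 2 * bernsteinApproximation m f x₀) =
      entanglementValue m := by
    intro m hm
    rw [entanglementValue, bernsteinApproximation.apply, Finset.mul_sum,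
      ← Fin.sum_univ_eq_sum_range
        (fun k => (m.choose k : ℝ) * (1 / 2 ^ (m - 1)) * F ((k : ℝ) / m))]
    congr 2
    refine Finset.sum_congr rfl fun k _ => ?_
    have hb : bernstein m k x₀ = m.choose k / 2 ^ m :=
      eval_half_bernsteinPolynomial (Finset.mem_range.mpr k.2)
    rw [hb, smul_eq_mul]
    change 2 * ((m.choose k : ℝ) / 2 ^ m * F ((k : ℕ) / m)) = _
    obtain ⟨n, rfl⟩ := Nat.exists_eq_add_of_le' hm
    rw [Nat.add_sub_cancel, pow_succ]
    field_simp
  have h3 : Filter.Tendsto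
      (fun m : ℕ => 1 / 4 * (3 - 1 / (m : ℝ) + 2 * bernsteinApproximation m f x₀))
      Filter.atTop (nhds (1 / 4 * (3 - 0 + 2 * (1 / 2)))) :=
    ((tendsto_const_nhds.sub tendsto_one_div_nat).add (h1.const_mul 2)).const_mul _
  have e : (1 / 4 * (3 - 0 + 2 * (1 / 2)) : ℝ) = 1 := by norm_num
  rw [e] at h3
  refine h3.congr' ?_
  filter_upwards [Filter.eventually_ge_atTop 1] with m hm using h2 m hm

lemma tendsto_measurementREE :
    Filter.Tendsto (fun m : ℕ => measurementREE (bellKraus m)) Filter.atTop (nhds 1) := by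
  refine ((continuous_coe_real_ereal.tendsto 1).comp tendsto_entanglementValue).congr' ?_
  filter_upwards [Filter.eventually_ge_atTop 1] with m hm
  exact (measurementREE_bellKraus hm).symm

lemma tendsto_averageREE :
    Filter.Tendsto (fun m : ℕ => averageREE (bellKraus m)) Filter.atTop (nhds 1) := by
  refine ((continuous_coe_real_ereal.tendsto 1).comp tendsto_entanglementValue).congr' ?_
  filter_upwards [Filter.eventually_ge_atTop 1] with m hm
  exact (averageREE_bellKraus hm).symm

open MvPolynomial

/-! ### Linear substitutions and the Fock space inner product -/

section Fock

variable {M : Type} [Fintype M] [DecidableEq M]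

/-- The substitution of creation operators induced by a transfer matrix. -/
def linSubst (U : Matrix M M ℂ) : MvPolynomial M ℂ →ₐ[ℂ] MvPolynomial M ℂ :=
  aeval fun i => ∑ j, C (U j i) * X j

lemma linSubst_X (U : Matrix M M ℂ) (i : M) : linSubst U (X i) = ∑ j, C (U j i) * X j :=
  aeval_X _ _

lemma linSubst_C (U : Matrix M M ℂ) (a : ℂ) : linSubst U (C a) = C a := algHom_C _ _

lemma linSubst_mul (U V : Matrix M M ℂ) :
    linSubst (U * V) = (linSubst U).comp (linSubst V) := by
  refine algHom_ext fun i => ?_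
  rw [AlgHom.comp_apply, linSubst_X, linSubst_X, map_sum]
  simp only [map_mul, linSubst_C, linSubst_X, Matrix.mul_apply, map_sum, Finset.mul_sum,
    Finset.sum_mul]
  rw [Finset.sum_comm]
  exact Finset.sum_congr rfl fun k _ => Finset.sum_congr rfl fun j _ => by ring

/-- The source of all conservation laws: a transfer matrix that couples only modes of equal weight
preserves the weighted degree. It is used for the total photon number, for the counts per `(s, t)`
and for parities. -/
lemma linSubst_isWeightedHomogeneous {A : Type} [AddCommMonoid A] {w : M → A}
    {U : Matrix M M ℂ} (hU : ∀ j i, U j i ≠ 0 → w j = w i) {p : MvPolynomial M ℂ} {a : A}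
    (hp : IsWeightedHomogeneous w p a) : IsWeightedHomogeneous w (linSubst U p) a := by
  have hX : ∀ i, IsWeightedHomogeneous w (linSubst U (X i)) (w i) := by
    intro i
    rw [linSubst_X]
    refine IsWeightedHomogeneous.sum _ _ _ fun j _ => ?_
    by_cases h : U j i = 0
    · rw [h, C_0, zero_mul]
      exact isWeightedHomogeneous_zero _ _ _
    · rw [← hU j i h]
      exact (isWeightedHomogeneous_X _ _ _).C_mul _
  rw [p.as_sum, map_sum]
  refine IsWeightedHomogeneous.sum _ _ _ fun d hd => ?_
  rw [monomial_eq, map_mul, linSubst_C, Finsupp.prod, map_prod]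
  refine IsWeightedHomogeneous.C_mul ?_ _
  rw [← hp (mem_support_iff.mp hd), Finsupp.weight_apply, Finsupp.sum]
  refine IsWeightedHomogeneous.prod _ _ _ fun i _ => ?_
  rw [map_pow]
  exact (hX i).pow _

/-- The squared norm of a monomial. -/
def multiFactorial (n : M →₀ ℕ) : ℕ := ∏ i, (n i).factorial

/-- The inner product of Fock space, for polynomials in the creation operators. -/
def fockInner (p q : MvPolynomial M ℂ) : ℂ :=
  ∑ n ∈ p.support, (multiFactorial n : ℂ) * (star (coeff n p) * coeff n q)

lemma fockInner_eq_sum {p : MvPolynomial M ℂ} (q : MvPolynomial M ℂ) {s : Finset (M →₀ ℕ)}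
    (hs : ∀ n ∉ s, coeff n p = 0) :
    fockInner p q = ∑ n ∈ s, (multiFactorial n : ℂ) * (star (coeff n p) * coeff n q) := by
  refine Finset.sum_subset (fun n hn => ?_) fun n _ hn => ?_
  · by_contra h
    exact mem_support_iff.mp hn (hs n h)
  · rw [notMem_support_iff.mp hn]
    simp

lemma fockInner_add_left (p p' q : MvPolynomial M ℂ) :
    fockInner (p + p') q = fockInner p q + fockInner p' q := by
  rw [fockInner_eq_sum q (p := p) (s := p.support ∪ p'.support),
    fockInner_eq_sum q (p := p') (s := p.support ∪ p'.support),
    fockInner_eq_sum q (p := p + p') (s := p.support ∪ p'.support), ← Finset.sum_add_distrib]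
  · refine Finset.sum_congr rfl fun n _ => ?_
    rw [coeff_add, star_add]
    ring
  all_goals
    intro n hn
    rw [Finset.mem_union, not_or, notMem_support_iff, notMem_support_iff] at hn
    simp [hn.1, hn.2]

lemma fockInner_C_mul_left (a : ℂ) (p q : MvPolynomial M ℂ) :
    fockInner (C a * p) q = star a * fockInner p q := by
  rw [fockInner_eq_sum q (p := C a * p) (s := p.support), fockInner, Finset.mul_sum]
  · refine Finset.sum_congr rfl fun n _ => ?_
    rw [coeff_C_mul, star_mul']
    ring
  · intro n hn
    rw [coeff_C_mul, notMem_support_iff.mp hn, mul_zero]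

lemma fockInner_zero_left (q : MvPolynomial M ℂ) : fockInner 0 q = 0 := by
  simp [fockInner]

lemma fockInner_sum_left {ι : Type} (s : Finset ι) (p : ι → MvPolynomial M ℂ)
    (q : MvPolynomial M ℂ) : fockInner (∑ i ∈ s, p i) q = ∑ i ∈ s, fockInner (p i) q := by
  classical
  induction s using Finset.induction_on with
  | empty => simp [fockInner_zero_left]
  | insert a s ha ih => rw [Finset.sum_insert ha, Finset.sum_insert ha, fockInner_add_left, ih]

lemma fockInner_sum_right {ι : Type} (s : Finset ι) (p : MvPolynomial M ℂ)
    (q : ι → MvPolynomial M ℂ) : fockInner p (∑ i ∈ s, q i) = ∑ i ∈ s, fockInner p (q i) := by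
  simp only [fockInner, coeff_sum, Finset.mul_sum]
  exact Finset.sum_comm

lemma fockInner_C_mul_right (a : ℂ) (p q : MvPolynomial M ℂ) :
    fockInner p (C a * q) = a * fockInner p q := by
  simp only [fockInner, coeff_C_mul, Finset.mul_sum]
  exact Finset.sum_congr rfl fun n _ => by ring

lemma multiFactorial_add_single (n : M →₀ ℕ) (i : M) :
    multiFactorial (n + Finsupp.single i 1) = (n i + 1) * multiFactorial n := by
  rw [multiFactorial, multiFactorial, ← Finset.mul_prod_erase _ _ (Finset.mem_univ i),
    ← Finset.mul_prod_erase _ (fun i => (n i).factorial) (Finset.mem_univ i), ← mul_assoc]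
  congr 1
  · simp [Nat.factorial_succ]
  · refine Finset.prod_congr rfl fun j hj => ?_
    simp [(Finset.ne_of_mem_erase hj).symm]

/-- Multiplication by a variable is adjoint to the partial derivative. -/
lemma fockInner_mul_X_left (p q : MvPolynomial M ℂ) (i : M) :
    fockInner (p * X i) q = fockInner p (pderiv i q) := by
  rw [fockInner, support_mul_X, Finset.sum_map, fockInner]
  refine Finset.sum_congr rfl fun n _ => ?_
  rw [addRightEmbedding_apply, coeff_mul_X, multiFactorial_add_single, coeff_pderiv]
  push_cast
  ring

lemma conjTranspose_mul_self_apply {U : Matrix M M ℂ} (hU : Uᴴ * U = 1) (i k : M) :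
    ∑ j, star (U j i) * U j k = if i = k then 1 else 0 := by
  rw [← Matrix.one_apply, ← hU, Matrix.mul_apply]
  rfl

/-- The chain rule produces the entries `U j k`, and unitarity contracts them with `star (U j i)` to
a Kronecker delta. -/
lemma sum_pderiv_linSubst {U : Matrix M M ℂ} (hU : Uᴴ * U = 1) (i : M) (q : MvPolynomial M ℂ) :
    ∑ j, C (star (U j i)) * pderiv j (linSubst U q) = linSubst U (pderiv i q) := by
  induction q using MvPolynomial.induction_on with
  | C a => simp
  | add p q hp hq => simp [← hp, ← hq, mul_add, Finset.sum_add_distrib]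
  | mul_X p k hp =>
    have h1 : ∀ j, pderiv j (linSubst U (X k)) = C (U j k) := by
      intro j
      rw [linSubst_X, map_sum, Finset.sum_eq_single j]
      · simp
      · intro l _ hl
        rw [pderiv_C_mul, pderiv_X_of_ne hl, mul_zero]
      · simp
    have h2 : ∑ j, C (star (U j i)) * C (U j k) = C (σ := M) (if i = k then (1 : ℂ) else 0) := by
      rw [← conjTranspose_mul_self_apply hU, map_sum]
      simp
    have h3 : linSubst U (pderiv i (X k)) = C (if i = k then (1 : ℂ) else 0) := by
      rw [pderiv_X]
      by_cases h : i = k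
      · subst h
        simp
      · simp [h, Ne.symm h]
    calc ∑ j, C (star (U j i)) * pderiv j (linSubst U (p * X k))
        = (∑ j, C (star (U j i)) * pderiv j (linSubst U p)) * linSubst U (X k) +
          linSubst U p * ∑ j, C (star (U j i)) * C (U j k) := by
          rw [Finset.sum_mul, Finset.mul_sum, ← Finset.sum_add_distrib]
          refine Finset.sum_congr rfl fun j _ => ?_
          rw [map_mul, pderiv_mul, h1]
          ring
      _ = _ := by rw [hp, h2, ← h3, ← map_mul, ← map_mul, ← map_add, pderiv_mul]

/-- Unitary substitutions preserve the inner product of Fock space. -/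
lemma fockInner_linSubst {U : Matrix M M ℂ} (hU : Uᴴ * U = 1) (p q : MvPolynomial M ℂ) :
    fockInner (linSubst U p) (linSubst U q) = fockInner p q := by
  have hconst : constantCoeff.comp (linSubst U : MvPolynomial M ℂ →+* MvPolynomial M ℂ) =
      constantCoeff := by
    refine MvPolynomial.ringHom_ext (fun a => ?_) fun i => ?_
    · simp
    · simp [linSubst_X]
  have hC : ∀ (a : ℂ) (q : MvPolynomial M ℂ), fockInner (C a) q = star a * constantCoeff q := by
    intro a q
    rw [fockInner_eq_sum q (s := {0})]
    · simp [multiFactorial, constantCoeff_eq]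
    · intro n hn
      rw [coeff_C, if_neg]
      exact fun h => hn (by simp [h])
  -- A variable split off from `p` acts as a derivative on the other argument, so `q` has to vary in
  -- the induction.
  induction p using MvPolynomial.induction_on generalizing q with
  | C a =>
    rw [linSubst_C, hC, hC]
    congr 1
    exact congrArg (fun f : MvPolynomial M ℂ →+* ℂ => f q) hconst
  | add p p' hp hp' => rw [map_add, fockInner_add_left, fockInner_add_left, hp, hp']
  | mul_X p i hp =>
    rw [fockInner_mul_X_left, ← hp, ← sum_pderiv_linSubst hU, fockInner_sum_right, map_mul,
      linSubst_X, Finset.mul_sum, fockInner_sum_left]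
    refine Finset.sum_congr rfl fun j _ => ?_
    rw [mul_left_comm, fockInner_C_mul_left, fockInner_mul_X_left, fockInner_C_mul_right]

/-- The norm of a combination of distinct monomials. -/
lemma fockInner_sum_monomial {ι : Type} [DecidableEq ι] (s : Finset ι) (e : ι → M →₀ ℕ)
    (he : Set.InjOn e s) (c : ι → ℂ) :
    fockInner (∑ i ∈ s, monomial (e i) (c i)) (∑ i ∈ s, monomial (e i) (c i)) =
      ∑ i ∈ s, (multiFactorial (e i) : ℂ) * ((‖c i‖ ^ 2 : ℝ) : ℂ) := by
  have hcoeff : ∀ i ∈ s, coeff (e i) (∑ j ∈ s, monomial (e j) (c j)) = c i := by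
    intro i hi
    rw [coeff_sum, Finset.sum_eq_single i]
    · simp
    · intro j hj hji
      rw [coeff_monomial, if_neg]
      exact fun h => hji (he hj hi h)
    · exact fun h => absurd hi h
  rw [fockInner_eq_sum _ (s := s.image e), Finset.sum_image he]
  · refine Finset.sum_congr rfl fun i hi => ?_
    rw [hcoeff i hi, RCLike.star_def, Complex.conj_mul']
    push_cast
    rfl
  · intro n hn
    rw [coeff_sum]
    refine Finset.sum_eq_zero fun j hj => ?_
    rw [coeff_monomial, if_neg]
    exact fun h => hn (Finset.mem_image.mpr ⟨j, hj, h⟩)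

lemma fockAmplitude_eq (U : Matrix M M ℂ) (n n' : M →₀ ℕ) :
    fockAmplitude U n n' = ((√(multiFactorial n) / √(multiFactorial n') : ℝ) : ℂ) *
      coeff n (linSubst U (monomial n' 1)) := by
  rw [fockAmplitude, linSubst, aeval_monomial, map_one, one_mul, Finsupp.prod_fintype]
  · rfl
  · intro i
    exact pow_zero _

end Fock

/-! ### Unitarity of the circuit -/

/-- The standard primitive root of unity. -/
def rootOfUnity (m : ℕ) : ℂ := Complex.exp (2 * Real.pi * Complex.I / m)

lemma rootOfUnity_isPrimitiveRoot {m : ℕ} (hm : 1 ≤ m) : IsPrimitiveRoot (rootOfUnity m) m :=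
  Complex.isPrimitiveRoot_exp m (by omega)

lemma star_rootOfUnity {m : ℕ} (hm : 1 ≤ m) : star (rootOfUnity m) = (rootOfUnity m)⁻¹ := by
  rw [RCLike.star_def, Complex.inv_eq_conj]
  exact (rootOfUnity_isPrimitiveRoot hm).norm'_eq_one (by omega)

lemma fourier_apply (m : ℕ) (j k : Fin m) :
    fourier m j k = rootOfUnity m ^ ((j : ℕ) * (k : ℕ)) / ((√m : ℝ) : ℂ) := by
  rw [fourier, of_apply, rootOfUnity, ← Complex.exp_nat_mul]
  congr 2
  push_cast
  ring

lemma fourier_unitary {m : ℕ} (hm : 1 ≤ m) : (fourier m)ᴴ * fourier m = 1 := by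
  have hω := rootOfUnity_isPrimitiveRoot hm
  have hω0 : rootOfUnity m ≠ 0 := hω.ne_zero (by omega)
  have hm0 : (m : ℂ) ≠ 0 := by exact_mod_cast (by omega : m ≠ 0)
  have hsq : ((√m : ℝ) : ℂ) * ((√m : ℝ) : ℂ) = m := by
    rw [← Complex.ofReal_mul, Real.mul_self_sqrt (Nat.cast_nonneg m)]
    simp
  ext k l
  rw [Matrix.mul_apply]
  have hterm : ∀ j : Fin m, (fourier m)ᴴ k j * fourier m j l =
      (rootOfUnity m ^ (l : ℕ) / rootOfUnity m ^ (k : ℕ)) ^ (j : ℕ) / m := by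
    intro j
    rw [conjTranspose_apply, fourier_apply, fourier_apply, star_div₀, star_pow,
      star_rootOfUnity hm, div_mul_div_comm, RCLike.star_def, Complex.conj_ofReal, hsq, div_pow,
      ← pow_mul, ← pow_mul, inv_pow, mul_comm (l : ℕ), mul_comm (k : ℕ), inv_mul_eq_div]
  rw [Finset.sum_congr rfl fun j _ => hterm j, ← Finset.sum_div,
    Fin.sum_univ_eq_sum_range
      (fun j => (rootOfUnity m ^ (l : ℕ) / rootOfUnity m ^ (k : ℕ)) ^ j)]
  by_cases hkl : k = l
  · subst hkl
    rw [div_self (pow_ne_zero _ hω0)]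
    simp [hm0]
  · rw [one_apply_ne hkl]
    have h1 : rootOfUnity m ^ (l : ℕ) / rootOfUnity m ^ (k : ℕ) ≠ 1 := by
      intro h
      rw [div_eq_one_iff_eq (pow_ne_zero _ hω0)] at h
      exact hkl (Fin.ext (hω.pow_inj l.2 k.2 h).symm)
    have h2 : (rootOfUnity m ^ (l : ℕ) / rootOfUnity m ^ (k : ℕ)) ^ m = 1 := by
      rw [div_pow, ← pow_mul, ← pow_mul, mul_comm (l : ℕ), mul_comm (k : ℕ), pow_mul, pow_mul,
        hω.pow_eq_one]
      simp
    rw [geom_sum_eq h1, h2]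
    simp

/-- The second layer of the circuit. -/
def secondLayer (m : ℕ) : Matrix (Mode m) (Mode m) ℂ :=
  fourier m ⊗ₖ (1 : Matrix (Fin 2 × Fin 2) (Fin 2 × Fin 2) ℂ)

lemma circuit_eq (m : ℕ) : circuit m = secondLayer m * firstLayer m := rfl

lemma secondLayer_unitary {m : ℕ} (hm : 1 ≤ m) : (secondLayer m)ᴴ * secondLayer m = 1 := by
  rw [secondLayer, conjTranspose_kronecker, conjTranspose_one, ← mul_kronecker_mul,
    fourier_unitary hm]
  simp

lemma firstLayer_unitary (m : ℕ) : (firstLayer m)ᴴ * firstLayer m = 1 := by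
  have hA : (fourier 2 ⊗ₖ (1 : Matrix (Fin 2) (Fin 2) ℂ))ᴴ * (fourier 2 ⊗ₖ 1) = 1 := by
    rw [conjTranspose_kronecker, conjTranspose_one, ← mul_kronecker_mul,
      fourier_unitary one_le_two]
    simp
  have hB : ((1 : Matrix (Fin 2) (Fin 2) ℂ) ⊗ₖ fourier 2)ᴴ * (1 ⊗ₖ fourier 2) = 1 := by
    rw [conjTranspose_kronecker, conjTranspose_one, ← mul_kronecker_mul,
      fourier_unitary one_le_two]
    simp
  ext ⟨j, a⟩ ⟨j', b⟩
  rw [Matrix.mul_apply, Fintype.sum_prod_type]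
  simp only [conjTranspose_apply]
  by_cases hj : j = j'
  · subst hj
    rw [Finset.sum_eq_single j]
    · simp only [firstLayer, of_apply, if_true]
      by_cases h0 : (j : ℕ) = 0
      · have := congrFun (congrFun hA a) b
        rw [Matrix.mul_apply] at this
        simp only [conjTranspose_apply] at this
        simp only [h0, if_true, this, Matrix.one_apply, Prod.mk.injEq, true_and]
      · have := congrFun (congrFun hB a) b
        rw [Matrix.mul_apply] at this
        simp only [conjTranspose_apply] at this
        simp only [h0, if_false, this, Matrix.one_apply, Prod.mk.injEq, true_and]
    · intro k _ hk
      simp [firstLayer, hk]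
    · simp
  · rw [one_apply_ne (by simp [hj])]
    refine Finset.sum_eq_zero fun k _ => Finset.sum_eq_zero fun c _ => ?_
    by_cases hk : k = j
    · subst hk
      simp [firstLayer, hj]
    · simp [firstLayer, hk]

lemma circuit_unitary {m : ℕ} (hm : 1 ≤ m) : (circuit m)ᴴ * circuit m = 1 := by
  rw [circuit_eq, conjTranspose_mul, Matrix.mul_assoc, ← Matrix.mul_assoc (secondLayer m)ᴴ,
    secondLayer_unitary hm, Matrix.one_mul, firstLayer_unitary]

/-! ### The states after the first layer -/

section FirstLayer

variable {m : ℕ} [NeZero m]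

/-- Pairs of modes that are coupled on the ancillas. -/
abbrev ModePair (m : ℕ) := Fin m × Fin 2

/-- The creation operator of the mode `t` of a pair. -/
def pairVar (p : ModePair m) (t : Fin 2) : MvPolynomial (Mode m) ℂ := X (p.1, p.2, t)

lemma rootOfUnity_two : rootOfUnity 2 = -1 := by
  rw [rootOfUnity, ← Complex.exp_pi_mul_I]
  congr 1
  push_cast
  ring

lemma fourier_two_apply (j k : Fin 2) :
    fourier 2 j k = (-1) ^ ((j : ℕ) * (k : ℕ)) * ((1 / √2 : ℝ) : ℂ) := by
  rw [fourier_apply, rootOfUnity_two]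
  push_cast
  ring

lemma linSubst_firstLayer_zero (s t : Fin 2) :
    linSubst (firstLayer m) (pairVar (0, s) t) =
      C ((1 / √2 : ℝ) : ℂ) * (pairVar (0, 0) t + (-1) ^ (s : ℕ) * pairVar (0, 1) t) := by
  rw [pairVar, linSubst_X, Fintype.sum_prod_type, Finset.sum_eq_single 0]
  · fin_cases s <;> fin_cases t <;>
      simp [firstLayer, Fintype.sum_prod_type, Fin.sum_univ_two, kroneckerMap_apply,
        fourier_two_apply, pairVar] <;> ring
  · intro j _ hj
    simp [firstLayer, hj]
  · simp

lemma linSubst_firstLayer_ne_zero {j : Fin m} (hj : j ≠ 0) (s t : Fin 2) :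
    linSubst (firstLayer m) (pairVar (j, s) t) =
      C ((1 / √2 : ℝ) : ℂ) * (pairVar (j, s) 0 + (-1) ^ (t : ℕ) * pairVar (j, s) 1) := by
  rw [pairVar, linSubst_X, Fintype.sum_prod_type, Finset.sum_eq_single j]
  · fin_cases s <;> fin_cases t <;>
      simp [firstLayer, Fintype.sum_prod_type, Fin.sum_univ_two, kroneckerMap_apply,
        fourier_two_apply, pairVar, hj] <;> ring
  · intro k _ hk
    simp [firstLayer, hk]
  · simp

lemma C_one_div_sqrt_two_sq :
    (C ((1 / √2 : ℝ) : ℂ) : MvPolynomial (Mode m) ℂ) ^ 2 = C (1 / 2) := by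
  rw [← C_pow, ← Complex.ofReal_pow, one_div_sqrt_two_sq]
  norm_num

/-- The state of a pair of ancilla modes after the first layer. -/
def pairDiff (p : ModePair m) : MvPolynomial (Mode m) ℂ := pairVar p 0 ^ 2 - pairVar p 1 ^ 2

/-- The state of all ancilla modes after the first layer. -/
def ancilla (m : ℕ) [NeZero m] : MvPolynomial (Mode m) ℂ :=
  ∏ j ∈ Finset.univ.erase (0 : Fin m), ∏ s, (C (1 / 2) * pairDiff (j, s))

lemma monomial_inputPhotons (x : TwoQubit) :
    monomial (inputPhotons m x) (1 : ℂ) = pairVar (0, 0) x.1 * pairVar (0, 1) x.2 *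
      ∏ j ∈ Finset.univ.erase (0 : Fin m), ∏ s, (pairVar (j, s) 0 * pairVar (j, s) 1) := by
  rw [monomial_eq, C_1, one_mul, Finsupp.prod_fintype _ _ (fun i => pow_zero _),
    Fintype.prod_prod_type, ← Finset.mul_prod_erase _ _ (Finset.mem_univ (0 : Fin m))]
  refine congrArg₂ (· * ·) ?_ ?_
  · obtain ⟨x, y⟩ := x
    fin_cases x <;> fin_cases y <;>
      simp [inputPhotons, Fintype.prod_prod_type, pairVar]
  · refine Finset.prod_congr rfl fun j hj => ?_
    have hj' : j ≠ 0 := Finset.ne_of_mem_erase hj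
    rw [Fintype.prod_prod_type]
    refine Finset.prod_congr rfl fun s _ => ?_
    simp [inputPhotons, hj', pairVar]

/-- Hong–Ou–Mandel interference: the two photons of an ancilla pair leave as `(a₀ + a₁)(a₀ - a₁)/2`.
-/
lemma linSubst_firstLayer_input (x : TwoQubit) :
    linSubst (firstLayer m) (monomial (inputPhotons m x) 1) =
      C (1 / 2) * (pairVar (0, 0) x.1 + pairVar (0, 1) x.1) *
        (pairVar (0, 0) x.2 - pairVar (0, 1) x.2) * ancilla m := by
  have hc := C_one_div_sqrt_two_sq (m := m)
  rw [monomial_inputPhotons, map_mul, map_mul, map_prod, linSubst_firstLayer_zero,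
    linSubst_firstLayer_zero, ancilla]
  refine congrArg₂ (· * ·) ?_ ?_
  · rw [← hc]
    simp
    ring
  · refine Finset.prod_congr rfl fun j hj => ?_
    rw [map_prod]
    refine Finset.prod_congr rfl fun s _ => ?_
    rw [map_mul, linSubst_firstLayer_ne_zero (Finset.ne_of_mem_erase hj),
      linSubst_firstLayer_ne_zero (Finset.ne_of_mem_erase hj), ← hc, pairDiff]
    simp
    ring

/-- The input state for a two-qubit ket. -/
def inputState (m : ℕ) (v : TwoQubit → ℂ) : MvPolynomial (Mode m) ℂ :=
  ∑ x, C (v x) * monomial (inputPhotons m x) 1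

lemma linSubst_firstLayer_inputState (v : TwoQubit → ℂ) :
    linSubst (firstLayer m) (inputState m v) =
      (∑ x, C (v x) * (C (1 / 2) * (pairVar (0, 0) x.1 + pairVar (0, 1) x.1) *
        (pairVar (0, 0) x.2 - pairVar (0, 1) x.2))) * ancilla m := by
  rw [inputState, map_sum, Finset.sum_mul]
  refine Finset.sum_congr rfl fun x _ => ?_
  rw [map_mul, linSubst_C, linSubst_firstLayer_input]
  ring

/-- For `ψ⁺` both photons end in the same row `s`, for `ψ⁻` in different rows; the parities detect
this. -/
lemma linSubst_firstLayer_psiPlus :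
    linSubst (firstLayer m) (inputState m psiPlus) = C ((1 / √2 : ℝ) : ℂ) *
      (pairVar (0, 0) 0 * pairVar (0, 0) 1 - pairVar (0, 1) 0 * pairVar (0, 1) 1) *
        ancilla m := by
  have h2 : (C (1 / 2) : MvPolynomial (Mode m) ℂ) * 2 = 1 := by
    rw [← map_ofNat C 2, ← C_mul]
    norm_num
  rw [linSubst_firstLayer_inputState]
  simp only [Fintype.sum_prod_type, Fin.sum_univ_two, psiPlus, ofReals_apply, cons_val_zero, cons_val_one,
    Complex.ofReal_zero, C_0]
  linear_combination C ((1 / √2 : ℝ) : ℂ) *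
    (pairVar (0, 0) 0 * pairVar (0, 0) 1 - pairVar (0, 1) 0 * pairVar (0, 1) 1) * ancilla m * h2

lemma linSubst_firstLayer_psiMinus :
    linSubst (firstLayer m) (inputState m psiMinus) = C ((1 / √2 : ℝ) : ℂ) *
      (pairVar (0, 1) 0 * pairVar (0, 0) 1 - pairVar (0, 0) 0 * pairVar (0, 1) 1) *
        ancilla m := by
  have h2 : (C (1 / 2) : MvPolynomial (Mode m) ℂ) * 2 = 1 := by
    rw [← map_ofNat C 2, ← C_mul]
    norm_num
  rw [linSubst_firstLayer_inputState]
  simp only [Fintype.sum_prod_type, Fin.sum_univ_two, psiMinus, ofReals_apply, cons_val_zero, cons_val_one,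
    Complex.ofReal_zero, C_0, Complex.ofReal_neg, C_neg]
  linear_combination C ((1 / √2 : ℝ) : ℂ) *
    (pairVar (0, 1) 0 * pairVar (0, 0) 1 - pairVar (0, 0) 0 * pairVar (0, 1) 1) * ancilla m * h2

/-- The pairs that are occupied in one of the two branches of the states `φ±`. -/
def branchPairs (m : ℕ) [NeZero m] (s : Fin 2) : Finset (ModePair m) :=
  -- In `Fin 2`, `s + 1` is the other row; its qubit pair is empty in the branch `s`.
  Finset.univ.erase (0, s + 1)

/-- A product state of all pairs of a branch, with relative amplitudes `σ`. -/
def branchState (σ : ModePair m → ℂ) (s : Fin 2) : MvPolynomial (Mode m) ℂ :=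
  ∏ p ∈ branchPairs m s, (pairVar p 0 ^ 2 + C (σ p) * pairVar p 1 ^ 2)

/-- The relative amplitudes with sign `+` for one pair and `-` for all other ones. -/
def flipSign (q p : ModePair m) : ℂ := if p = q then 1 else -1

/-- The normalization of the branches. -/
def branchNorm (m : ℕ) : ℂ := ((1 / √2 : ℝ) : ℂ) * (1 / 2) ^ (2 * m - 1)

lemma ancilla_eq : ancilla m = C ((1 / 2) ^ (2 * m - 2)) *
    ∏ j ∈ Finset.univ.erase (0 : Fin m), ∏ s, pairDiff (j, s) := by
  have hm : 2 * (m - 1) = 2 * m - 2 := by omega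
  simp only [ancilla, Finset.prod_mul_distrib, Finset.prod_const, Finset.card_univ,
    Fintype.card_fin, Finset.card_erase_of_mem (Finset.mem_univ _), ← pow_mul, hm, C_pow]

lemma prod_branchPairs (f : ModePair m → MvPolynomial (Mode m) ℂ) (s : Fin 2) :
    ∏ p ∈ branchPairs m s, f p =
      f (0, s) * ∏ j ∈ Finset.univ.erase (0 : Fin m), ∏ s, f (j, s) := by
  have h : branchPairs m s =
      insert (0, s) ((Finset.univ.erase (0 : Fin m)) ×ˢ (Finset.univ : Finset (Fin 2))) := by
    ext ⟨j, s'⟩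
    by_cases hj : j = 0
    · subst hj
      fin_cases s <;> fin_cases s' <;> simp [branchPairs]
    · simp [branchPairs, hj]
  rw [h, Finset.prod_insert (by simp), Finset.prod_product]

lemma branchState_neg_one (s : Fin 2) : branchState (fun _ : ModePair m => (-1 : ℂ)) s =
    pairDiff (0, s) * ∏ j ∈ Finset.univ.erase (0 : Fin m), ∏ s, pairDiff (j, s) := by
  rw [← prod_branchPairs]
  refine Finset.prod_congr rfl fun p _ => ?_
  rw [pairDiff, C_neg, C_1]
  ring

lemma branchState_flipSign (s : Fin 2) : branchState (flipSign ((0, s) : ModePair m)) s =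
    (pairVar (0, s) 0 ^ 2 + pairVar (0, s) 1 ^ 2) *
      ∏ j ∈ Finset.univ.erase (0 : Fin m), ∏ s, pairDiff (j, s) := by
  rw [branchState, prod_branchPairs]
  refine congrArg₂ (· * ·) ?_ ?_
  · simp [flipSign]
  · refine Finset.prod_congr rfl fun j hj => Finset.prod_congr rfl fun s' _ => ?_
    have : ((j, s') : ModePair m) ≠ (0, s) := fun h =>
      Finset.ne_of_mem_erase hj (congrArg Prod.fst h)
    rw [flipSign, if_neg this, pairDiff, C_neg, C_1]
    ring

lemma branchNorm_eq : (C (branchNorm m) : MvPolynomial (Mode m) ℂ) =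
    C ((1 / √2 : ℝ) : ℂ) * C (1 / 2) * C ((1 / 2) ^ (2 * m - 2)) := by
  have hm : 2 * m - 1 = 2 * m - 2 + 1 := by
    have := NeZero.pos m
    omega
  rw [← C_mul, ← C_mul, branchNorm, hm, pow_succ]
  congr 1
  ring

/-- In each branch the qubit pair looks exactly like an ancilla pair. This makes `φ⁻` shift
invariant. -/
lemma linSubst_firstLayer_phiMinus :
    linSubst (firstLayer m) (inputState m phiMinus) = C (branchNorm m) *
      (branchState (fun _ => -1) 0 - branchState (fun _ => -1) 1) := by
  rw [branchState_neg_one, branchState_neg_one, branchNorm_eq]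
  rw [linSubst_firstLayer_inputState]
  simp only [Fintype.sum_prod_type, Fin.sum_univ_two, phiMinus, ofReals_apply, cons_val_zero, cons_val_one,
    Complex.ofReal_zero, C_0, Complex.ofReal_neg, C_neg, ancilla_eq]
  rw [pairDiff, pairDiff]
  ring

lemma linSubst_firstLayer_phiPlus :
    linSubst (firstLayer m) (inputState m phiPlus) = C (branchNorm m) *
      (branchState (flipSign (0, 0)) 0 - branchState (flipSign (0, 1)) 1) := by
  rw [branchState_flipSign, branchState_flipSign, branchNorm_eq]
  rw [linSubst_firstLayer_inputState]
  simp only [Fintype.sum_prod_type, Fin.sum_univ_two, phiPlus, ofReals_apply, cons_val_zero, cons_val_one,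
    Complex.ofReal_zero, C_0, ancilla_eq]
  ring

end FirstLayer

/-! ### Conserved photon counts: branch and level of a detection pattern -/

section Branches

variable {m : ℕ} [NeZero m]

lemma prod_mode {R : Type} [CommMonoid R] (f : Mode m → R) :
    ∏ q, f q = ∏ p : ModePair m, ∏ t, f (p.1, p.2, t) := by
  simp only [Fintype.prod_prod_type]

lemma sum_mode {R : Type} [AddCommMonoid R] (f : Mode m → R) :
    ∑ q, f q = ∑ p : ModePair m, ∑ t, f (p.1, p.2, t) := by
  simp only [Fintype.sum_prod_type]

/-- Occupation numbers with two photons in one mode of each pair of a branch: in the mode `1` for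
the pairs in `T`, and in the mode `0` for the other ones. -/
def branchOcc (s : Fin 2) (T : Finset (ModePair m)) : Mode m →₀ ℕ :=
  Finsupp.equivFunOnFinite.symm fun q =>
    if (q.1, q.2.1) ∈ branchPairs m s ∧ q.2.2 = (if (q.1, q.2.1) ∈ T then 1 else 0) then 2 else 0

lemma branchOcc_apply (s : Fin 2) (T : Finset (ModePair m)) (p : ModePair m) (t : Fin 2) :
    branchOcc s T (p.1, p.2, t) =
      if p ∈ branchPairs m s ∧ t = (if p ∈ T then 1 else 0) then 2 else 0 := rfl

lemma monomial_branchOcc {s : Fin 2} {T : Finset (ModePair m)} (hT : T ⊆ branchPairs m s) :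
    monomial (branchOcc s T) (1 : ℂ) =
      (∏ p ∈ T, pairVar p 1 ^ 2) * ∏ p ∈ branchPairs m s \ T, pairVar p 0 ^ 2 := by
  rw [monomial_eq, C_1, one_mul, Finsupp.prod_fintype _ _ (fun i => pow_zero _), prod_mode]
  have h : ∀ p : ModePair m,
      ∏ t, (X (p.1, p.2, t) : MvPolynomial (Mode m) ℂ) ^ branchOcc s T (p.1, p.2, t) =
        if p ∈ branchPairs m s then (if p ∈ T then pairVar p 1 ^ 2 else pairVar p 0 ^ 2)
          else 1 := by
    intro p
    rw [Fin.prod_univ_two, branchOcc_apply, branchOcc_apply]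
    by_cases h1 : p ∈ branchPairs m s <;> by_cases h2 : p ∈ T <;> simp [h1, h2, pairVar]
  rw [Finset.prod_congr rfl fun p _ => h p, Finset.prod_ite_mem, Finset.univ_inter,
    ← Finset.prod_sdiff hT, mul_comm]
  refine congrArg₂ (· * ·) ?_ ?_
  · exact Finset.prod_congr rfl fun p hp => if_pos hp
  · exact Finset.prod_congr rfl fun p hp => if_neg (Finset.mem_sdiff.mp hp).2

lemma branchState_eq_sum (σ : ModePair m → ℂ) (s : Fin 2) :
    branchState σ s =
      ∑ T ∈ (branchPairs m s).powerset, C (∏ p ∈ T, σ p) * monomial (branchOcc s T) 1 := by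
  rw [branchState, Finset.prod_congr rfl fun p _ => add_comm _ _, Finset.prod_add]
  refine Finset.sum_congr rfl fun T hT => ?_
  rw [monomial_branchOcc (Finset.mem_powerset.mp hT), Finset.prod_mul_distrib, map_prod, mul_assoc]

/-- The number of photons, weighted with a function of the two lower mode indices. -/
def photonCount (f : Fin 2 → Fin 2 → ℕ) (n : Mode m →₀ ℕ) : ℕ := ∑ q, n q * f q.2.1 q.2.2

lemma weight_eq_photonCount (f : Fin 2 → Fin 2 → ℕ) (n : Mode m →₀ ℕ) :
    Finsupp.weight (fun q : Mode m => f q.2.1 q.2.2) n = photonCount f n := by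
  rw [Finsupp.weight_apply, Finsupp.sum_fintype _ _ fun i => by simp]
  rfl

lemma secondLayer_ne_zero {q r : Mode m} (h : secondLayer m q r ≠ 0) : q.2 = r.2 := by
  by_contra hne
  exact h (by rw [secondLayer, kroneckerMap_apply, one_apply_ne hne, mul_zero])

/-- The Fourier layer mixes only the index `j`, so each `(s, t)` keeps its photon number. -/
lemma photonCount_eq_of_coeff_ne_zero {e n : Mode m →₀ ℕ}
    (h : coeff n (linSubst (secondLayer m) (monomial e 1)) ≠ 0) (f : Fin 2 → Fin 2 → ℕ) :
    photonCount f n = photonCount f e := by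
  rw [← weight_eq_photonCount, ← weight_eq_photonCount]
  refine linSubst_isWeightedHomogeneous (fun q r hqr => ?_)
    (isWeightedHomogeneous_monomial _ e 1 rfl) h
  rw [secondLayer_ne_zero hqr]

lemma photonCount_branchOcc (f : Fin 2 → Fin 2 → ℕ) (s : Fin 2) (T : Finset (ModePair m)) :
    photonCount f (branchOcc s T) =
      ∑ p ∈ branchPairs m s, 2 * f p.2 (if p ∈ T then 1 else 0) := by
  rw [photonCount, sum_mode, ← Finset.univ_inter (branchPairs m s), ← Finset.sum_ite_mem]
  refine Finset.sum_congr rfl fun p _ => ?_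
  simp only [branchOcc_apply, Fin.sum_univ_two]
  by_cases h1 : p ∈ branchPairs m s <;> by_cases h2 : p ∈ T <;> simp [h1, h2]

/-- The branch of the states `φ±` that a detection pattern belongs to. -/
def branch (n : Mode m →₀ ℕ) : Fin 2 :=
  -- Row `0` holds `2 * m` photons in branch `0`, but only `2 * m - 2` in branch `1`, where its
  -- qubit pair is empty.
  if photonCount (fun s _ => if s = 0 then 1 else 0) n = 2 * m then 0 else 1

/-- Half the number of photons in the modes `1` of the pairs of the branch. -/
def level (n : Mode m →₀ ℕ) : ℕ :=
  photonCount (fun s t => if s = branch n ∧ t = 1 then 1 else 0) n / 2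

/-- The number of pairs of a row in `T`. -/
def rowCard (s : Fin 2) (T : Finset (ModePair m)) : ℕ := (T.filter fun p => p.2 = s).card

lemma branch_branchOcc (s : Fin 2) (T : Finset (ModePair m)) : branch (branchOcc s T) = s := by
  have hm := NeZero.pos m
  have h := Finset.add_sum_erase Finset.univ
    (fun p : ModePair m => 2 * (if p.2 = 0 then 1 else 0)) (Finset.mem_univ (0, s + 1))
  have h2 : ∑ p : ModePair m, 2 * (if p.2 = 0 then 1 else 0) = 2 * m := by
    simp [Fintype.sum_prod_type, mul_comm]
  rw [h2] at h
  rw [branch, photonCount_branchOcc, branchPairs]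
  fin_cases s
  · simp only [Fin.zero_eta, zero_add, one_ne_zero, if_false, mul_zero] at h ⊢
    rw [if_pos h]
  · rw [if_neg]
    · rfl
    · intro h'
      rw [h'] at h
      simp at h

lemma level_branchOcc {s : Fin 2} {T : Finset (ModePair m)} (hT : T ⊆ branchPairs m s) :
    level (branchOcc s T) = rowCard s T := by
  rw [level, branch_branchOcc, photonCount_branchOcc, ← Finset.mul_sum,
    Nat.mul_div_cancel_left _ two_pos, rowCard, Finset.card_filter,
    ← Finset.sum_subset hT (f := fun p => if p.2 = s ∧ (if p ∈ T then 1 else 0) = (1 : Fin 2) then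
      1 else 0)]
  · refine Finset.sum_congr rfl fun p hp => ?_
    simp [hp]
  · intro p _ hp
    simp [hp]

lemma branch_level_of_coeff_ne_zero {s : Fin 2} {T : Finset (ModePair m)}
    (hT : T ⊆ branchPairs m s) {n : Mode m →₀ ℕ}
    (h : coeff n (linSubst (secondLayer m) (monomial (branchOcc s T) 1)) ≠ 0) :
    branch n = s ∧ level n = rowCard s T := by
  have h1 : branch n = branch (branchOcc s T) := by
    rw [branch, branch, photonCount_eq_of_coeff_ne_zero h]
  refine ⟨h1.trans (branch_branchOcc s T), ?_⟩
  rw [← level_branchOcc hT, level, level, h1, photonCount_eq_of_coeff_ne_zero h]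

lemma coeff_branchState (σ : ModePair m → ℂ) (s : Fin 2) (n : Mode m →₀ ℕ) :
    coeff n (linSubst (secondLayer m) (branchState σ s)) =
      ∑ T ∈ (branchPairs m s).powerset, (∏ p ∈ T, σ p) *
        coeff n (linSubst (secondLayer m) (monomial (branchOcc s T) 1)) := by
  simp only [branchState_eq_sum, map_sum, map_mul, linSubst_C, coeff_sum, coeff_C_mul]

lemma coeff_branchState_of_branch_ne (σ : ModePair m → ℂ) {s : Fin 2} {n : Mode m →₀ ℕ}
    (h : branch n ≠ s) : coeff n (linSubst (secondLayer m) (branchState σ s)) = 0 := by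
  rw [coeff_branchState]
  refine Finset.sum_eq_zero fun T hT => ?_
  by_contra hne
  exact h (branch_level_of_coeff_ne_zero (Finset.mem_powerset.mp hT)
    (right_ne_zero_of_mul hne)).1

lemma rowCard_eq (s : Fin 2) (T : Finset (ModePair m)) :
    rowCard s T = ∑ i : Fin m, if (i, s) ∈ T then 1 else 0 := by
  have : T.filter (fun p => p.2 = s) = Finset.univ.filter fun p => p ∈ T ∧ p.2 = s := by
    ext p
    simp
  rw [rowCard, this, Finset.card_filter, Fintype.sum_prod_type]
  refine Finset.sum_congr rfl fun i _ => ?_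
  rw [Finset.sum_eq_single s]
  · simp
  · intro t _ ht
    simp [ht]
  · simp

lemma rowCard_le (s : Fin 2) (T : Finset (ModePair m)) : rowCard s T ≤ m := by
  rw [rowCard_eq]
  calc _ ≤ ∑ _i : Fin m, 1 := Finset.sum_le_sum fun i _ => by split_ifs <;> simp
    _ = m := by simp

lemma coeff_branchState_of_lt_level (σ : ModePair m → ℂ) (s : Fin 2) {n : Mode m →₀ ℕ}
    (h : m < level n) : coeff n (linSubst (secondLayer m) (branchState σ s)) = 0 := by
  rw [coeff_branchState]
  refine Finset.sum_eq_zero fun T hT => ?_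
  by_contra hne
  have := (branch_level_of_coeff_ne_zero (Finset.mem_powerset.mp hT)
    (right_ne_zero_of_mul hne)).2
  have := rowCard_le s T
  omega

/-- Relative to all signs `-1`, flipping the sign of `(i, s)` gives a factor `-1` if that pair is in
`T` and `1` otherwise. -/
lemma sum_prod_flipSign (s : Fin 2) (T : Finset (ModePair m)) :
    ∑ i : Fin m, ∏ p ∈ T, flipSign (i, s) p = ((m : ℂ) - 2 * rowCard s T) * ∏ _p ∈ T, (-1) := by
  have h : ∀ i : Fin m, ∏ p ∈ T, flipSign (i, s) p =
      (1 - 2 * (if (i, s) ∈ T then 1 else 0)) * ∏ _p ∈ T, (-1 : ℂ) := by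
    intro i
    have h1 : ∀ p ∈ T, flipSign (i, s) p = (if p = (i, s) then -1 else 1) * (-1) := by
      intro p _
      rw [flipSign]
      split_ifs <;> norm_num
    rw [Finset.prod_congr rfl h1, Finset.prod_mul_distrib, Finset.prod_ite_eq']
    split_ifs <;> norm_num
  rw [Finset.sum_congr rfl fun i _ => h i, ← Finset.sum_mul, Finset.sum_sub_distrib,
    ← Finset.mul_sum, rowCard_eq]
  push_cast
  simp

/-- All `T` that contribute to the pattern `n` have the same `rowCard`, namely `level n`, so the
factor leaves the sum. -/
lemma sum_coeff_branchState_flipSign {s : Fin 2} (n : Mode m →₀ ℕ) :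
    ∑ i : Fin m, coeff n (linSubst (secondLayer m) (branchState (flipSign (i, s)) s)) =
      ((m : ℂ) - 2 * level n) *
        coeff n (linSubst (secondLayer m) (branchState (fun _ => -1) s)) := by
  simp only [coeff_branchState, Finset.mul_sum]
  rw [Finset.sum_comm]
  refine Finset.sum_congr rfl fun T hT => ?_
  rw [← Finset.sum_mul, sum_prod_flipSign]
  by_cases h : coeff n (linSubst (secondLayer m) (monomial (branchOcc s T) 1)) = 0
  · simp [h]
  · rw [(branch_level_of_coeff_ne_zero (Finset.mem_powerset.mp hT) h).2]
    ring

end Branches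

/-! ### Cyclic shifts -/

section Shift

variable {m : ℕ} [NeZero m]

/-- The cyclic shift of the pairs of one row. -/
def pairShift (s : Fin 2) (i : Fin m) : Equiv.Perm (ModePair m) where
  toFun p := if p.2 = s then (p.1 + i, p.2) else p
  invFun p := if p.2 = s then (p.1 - i, p.2) else p
  left_inv p := by
    by_cases h : p.2 = s <;> simp [h]
    exact Prod.ext rfl h.symm
  right_inv p := by
    by_cases h : p.2 = s <;> simp [h]
    exact Prod.ext rfl h.symm

/-- The cyclic shift of the modes of one row. -/
def modeShift (s : Fin 2) (i : Fin m) (q : Mode m) : Mode m :=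
  if q.2.1 = s then (q.1 + i, q.2) else q

lemma rename_pairVar (s : Fin 2) (i : Fin m) (p : ModePair m) (t : Fin 2) :
    rename (modeShift s i) (pairVar p t) = pairVar (pairShift s i p) t := by
  rw [pairVar, rename_X, pairVar]
  congr 1
  by_cases h : p.2 = s <;> simp [modeShift, pairShift, h]

lemma rename_branchState {s : Fin 2} {i : Fin m} {σ σ' : ModePair m → ℂ}
    (hσ : ∀ p, σ p = σ' (pairShift s i p)) :
    rename (modeShift s i) (branchState σ s) = branchState σ' s := by
  rw [branchState, map_prod, branchState]
  refine Finset.prod_equiv (pairShift s i) (fun p => ?_) fun p _ => ?_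
  · have hfix : pairShift s i (0, s + 1) = (0, s + 1) := by
      have : s + 1 ≠ s := by fin_cases s <;> decide
      simp [pairShift, this]
    simp only [branchPairs, Finset.mem_erase, Finset.mem_univ, and_true]
    conv_rhs => rw [← hfix]
    rw [(pairShift s i).injective.ne_iff]
  · rw [map_add, map_mul, map_pow, map_pow, rename_C, rename_pairVar, rename_pairVar, hσ]

lemma rename_branchState_neg_one (s : Fin 2) (i : Fin m) :
    rename (modeShift s i) (branchState (fun _ => -1) s) = branchState (fun _ => -1) s :=
  rename_branchState fun _ => rfl

lemma rename_branchState_flipSign (s : Fin 2) (i : Fin m) :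
    rename (modeShift s i) (branchState (flipSign (0, s)) s) = branchState (flipSign (i, s)) s := by
  refine rename_branchState fun p => ?_
  have h0 : pairShift s i (0, s) = (i, s) := by simp [pairShift]
  rw [flipSign, flipSign, ← h0]
  simp only [(pairShift s i).injective.eq_iff]

/-- Multiplication of every creation operator by a phase. -/
lemma coeff_aeval_phase (ζ : Mode m → ℂ) (p : MvPolynomial (Mode m) ℂ) (n : Mode m →₀ ℕ) :
    coeff n (aeval (fun q => C (ζ q) * X q : Mode m → MvPolynomial (Mode m) ℂ) p) =
      (∏ q, ζ q ^ n q) * coeff n p := by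
  induction p using MvPolynomial.induction_on' with
  | add p q hp hq => rw [map_add, coeff_add, coeff_add, hp, hq, mul_add]
  | monomial e a =>
    have h : aeval (fun q => C (ζ q) * X q : Mode m → MvPolynomial (Mode m) ℂ) (monomial e a) =
        C (∏ q, ζ q ^ e q) * monomial e a := by
      rw [aeval_monomial, Finsupp.prod_fintype _ _ (fun i => pow_zero _), monomial_eq,
        Finsupp.prod_fintype _ _ (fun i => pow_zero _)]
      simp only [mul_pow, Finset.prod_mul_distrib, map_prod, map_pow, algebraMap_eq]
      ring
    rw [h, coeff_C_mul, coeff_monomial]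
    split_ifs with hen
    · rw [hen]
    · simp

/-- The phase that a shift of one row at the input causes for a detection pattern. -/
def patternPhase (s : Fin 2) (i : Fin m) (n : Mode m →₀ ℕ) : ℂ :=
  ∏ q : Mode m, (if q.2.1 = s then rootOfUnity m ^ ((q.1 : ℕ) * (i : ℕ)) else 1) ^ n q

lemma fourier_add (l j i : Fin m) :
    fourier m l (j + i) = fourier m l j * rootOfUnity m ^ ((l : ℕ) * (i : ℕ)) := by
  have h : (rootOfUnity m ^ (l : ℕ)) ^ m = 1 := by
    rw [← pow_mul, mul_comm, pow_mul, (rootOfUnity_isPrimitiveRoot (NeZero.pos m)).pow_eq_one,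
      one_pow]
  rw [fourier_apply, fourier_apply, Fin.val_add, pow_mul, ← pow_eq_pow_mod _ h, pow_add, pow_mul,
    pow_mul]
  ring

/-- The Fourier transform diagonalizes cyclic shifts: a shift before the second layer is a phase on
each mode after it. -/
lemma coeff_linSubst_rename (s : Fin 2) (i : Fin m) (p : MvPolynomial (Mode m) ℂ)
    (n : Mode m →₀ ℕ) :
    coeff n (linSubst (secondLayer m) (rename (modeShift s i) p)) =
      patternPhase s i n * coeff n (linSubst (secondLayer m) p) := by
  rw [patternPhase, ← coeff_aeval_phase]
  congr 1
  have h : (linSubst (secondLayer m)).comp (rename (modeShift s i)) =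
      (aeval (fun q => C (if q.2.1 = s then rootOfUnity m ^ ((q.1 : ℕ) * (i : ℕ)) else 1) * X q :
        Mode m → MvPolynomial (Mode m) ℂ)).comp (linSubst (secondLayer m)) := by
    refine algHom_ext fun r => ?_
    rw [AlgHom.comp_apply, AlgHom.comp_apply, rename_X, linSubst_X, linSubst_X, map_sum]
    refine Finset.sum_congr rfl fun q _ => ?_
    rw [map_mul, aeval_X, algHom_C, algebraMap_eq, ← mul_assoc, ← C_mul]
    congr 2
    simp only [secondLayer, kroneckerMap_apply, modeShift]
    have h1 : (if r.2.1 = s then (r.1 + i, r.2) else r).2 = r.2 := by split_ifs <;> rfl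
    rw [h1]
    by_cases hqr : q.2 = r.2
    · rw [hqr]
      split_ifs
      · rw [fourier_add]
        ring
      · rw [mul_one]
    · rw [one_apply_ne hqr]
      simp
  exact congrArg (fun f : MvPolynomial (Mode m) ℂ →ₐ[ℂ] MvPolynomial (Mode m) ℂ => f p) h

/-- Detection patterns that are compatible with a shift invariant input. -/
def Neutral (n : Mode m →₀ ℕ) : Prop := ∀ i : Fin m, patternPhase (branch n) i n = 1

/-- Shift invariance makes the amplitude equal to itself times a phase other than one. -/
lemma coeff_branchState_of_not_neutral (s : Fin 2) {n : Mode m →₀ ℕ} (h : ¬ Neutral n) :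
    coeff n (linSubst (secondLayer m) (branchState (fun _ => -1) s)) = 0 := by
  by_cases hs : branch n = s
  · subst hs
    obtain ⟨i, hi⟩ := not_forall.mp h
    have := coeff_linSubst_rename (branch n) i (branchState (fun _ => -1) (branch n)) n
    rw [rename_branchState_neg_one] at this
    have h2 : (patternPhase (branch n) i n - 1) *
        coeff n (linSubst (secondLayer m) (branchState (fun _ => -1) (branch n))) = 0 := by
      linear_combination -this
    exact (mul_eq_zero.mp h2).resolve_left (sub_ne_zero.mpr hi)
  · exact coeff_branchState_of_branch_ne _ hs

/-- For a neutral pattern all `m` positions of the flipped sign in its row have the same amplitude,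
so each equals their mean. -/
lemma coeff_branchState_flipSign {n : Mode m →₀ ℕ} (h : Neutral n) (s : Fin 2) :
    coeff n (linSubst (secondLayer m) (branchState (flipSign (0, s)) s)) =
      ((m : ℂ) - 2 * level n) / m *
        coeff n (linSubst (secondLayer m) (branchState (fun _ => -1) s)) := by
  by_cases hs : branch n = s
  · have h1 := sum_coeff_branchState_flipSign (s := s) n
    have h2 : ∀ i : Fin m, coeff n (linSubst (secondLayer m) (branchState (flipSign (i, s)) s)) =
        coeff n (linSubst (secondLayer m) (branchState (flipSign (0, s)) s)) := by
      intro i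
      rw [← rename_branchState_flipSign, coeff_linSubst_rename, ← hs, h i, one_mul]
    rw [Finset.sum_congr rfl fun i _ => h2 i, Finset.sum_const, Finset.card_univ,
      Fintype.card_fin, nsmul_eq_mul] at h1
    have hm : (m : ℂ) ≠ 0 := NeZero.ne _
    field_simp
    linear_combination h1
  · rw [coeff_branchState_of_branch_ne _ hs, coeff_branchState_of_branch_ne _ hs, mul_zero]

end Shift

/-! ### Norms of the level components and of the input states -/

section Norms

variable {m : ℕ} [NeZero m]

/-- The labels of the Fock states in the superposition `φ⁻` after the first layer that have `k`
pairs in the second position in the row of the branch. -/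
def levelLabels (m : ℕ) [NeZero m] (k : ℕ) : Finset (Fin 2 × Finset (ModePair m)) :=
  Finset.univ.filter fun a => a.2 ⊆ branchPairs m a.1 ∧ rowCard a.1 a.2 = k

/-- The part of the state `φ⁻` after the first layer that has level `k`. -/
def levelState (m : ℕ) [NeZero m] (k : ℕ) : MvPolynomial (Mode m) ℂ :=
  ∑ a ∈ levelLabels m k, monomial (branchOcc a.1 a.2)
    (branchNorm m * (-1) ^ (a.1 : ℕ) * ∏ _p ∈ a.2, (-1))

lemma linSubst_firstLayer_phiMinus_eq_sum :
    linSubst (firstLayer m) (inputState m phiMinus) =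
      ∑ a ∈ Finset.univ.filter
        (fun a : Fin 2 × Finset (ModePair m) => a.2 ⊆ branchPairs m a.1),
        monomial (branchOcc a.1 a.2) (branchNorm m * (-1) ^ (a.1 : ℕ) * ∏ _p ∈ a.2, (-1)) := by
  have h : ∀ s : Fin 2, C (branchNorm m * (-1) ^ (s : ℕ)) * branchState (fun _ => -1) s =
      ∑ T : Finset (ModePair m), if T ⊆ branchPairs m s then
        monomial (branchOcc s T) (branchNorm m * (-1) ^ (s : ℕ) * ∏ _p ∈ T, (-1)) else 0 := by
    intro s
    rw [branchState_eq_sum, Finset.mul_sum, ← Finset.sum_filter]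
    refine Finset.sum_congr ?_ fun T _ => ?_
    · ext T
      simp
    · rw [← mul_assoc, ← C_mul, C_mul_monomial, mul_one]
  rw [linSubst_firstLayer_phiMinus, Finset.sum_filter, Fintype.sum_prod_type, Fin.sum_univ_two]
  dsimp only
  rw [← h, ← h]
  simp
  ring

/-- As the level is conserved, projecting before the second layer selects the patterns of level `k`
after it. Their total probability thus follows without evaluating amplitudes. -/
lemma coeff_levelState (k : ℕ) (n : Mode m →₀ ℕ) :
    coeff n (linSubst (secondLayer m) (levelState m k)) = if level n = k then
      coeff n (linSubst (secondLayer m) (linSubst (firstLayer m) (inputState m phiMinus)))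
      else 0 := by
  have hmon : ∀ (e : Mode m →₀ ℕ) (c : ℂ), coeff n (linSubst (secondLayer m) (monomial e c)) =
      c * coeff n (linSubst (secondLayer m) (monomial e 1)) := by
    intro e c
    rw [← coeff_C_mul, ← linSubst_C (secondLayer m), ← map_mul, C_mul_monomial, mul_one]
  rw [levelState, linSubst_firstLayer_phiMinus_eq_sum, map_sum, map_sum, coeff_sum, coeff_sum,
    levelLabels, ← Finset.filter_filter,
    Finset.sum_filter fun a : Fin 2 × Finset (ModePair m) => rowCard a.1 a.2 = k]
  split_ifs with hk
  · refine Finset.sum_congr rfl fun a ha => ?_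
    by_cases h : coeff n (linSubst (secondLayer m) (monomial (branchOcc a.1 a.2) 1)) = 0
    · rw [hmon, h, mul_zero, ite_self]
    · rw [if_pos]
      rw [← (branch_level_of_coeff_ne_zero (Finset.mem_filter.mp ha).2 h).2, hk]
  · refine Finset.sum_eq_zero fun a ha => ?_
    split_ifs with hak
    · by_cases h : coeff n (linSubst (secondLayer m) (monomial (branchOcc a.1 a.2) 1)) = 0
      · rw [hmon, h, mul_zero]
      · exact absurd ((branch_level_of_coeff_ne_zero (Finset.mem_filter.mp ha).2 h).2.trans hak) hk
    · rfl

lemma branchOcc_injOn (k : ℕ) :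
    Set.InjOn (fun a : Fin 2 × Finset (ModePair m) => branchOcc a.1 a.2) (levelLabels m k) := by
  rintro ⟨s, T⟩ ha ⟨s', T'⟩ ha' h
  have hT := (Finset.mem_filter.mp ha).2.1
  have hT' := (Finset.mem_filter.mp ha').2.1
  dsimp only at h hT hT'
  have hs : s = s' := by rw [← branch_branchOcc s T, h, branch_branchOcc]
  subst hs
  have hmem : ∀ {T : Finset (ModePair m)}, T ⊆ branchPairs m s → ∀ p,
      p ∈ T ↔ branchOcc s T (p.1, p.2, 1) = 2 := by
    intro T hT p
    rw [branchOcc_apply]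
    by_cases hp : p ∈ T
    · simp [hp, hT hp]
    · simp [hp]
  ext p
  · rfl
  · rw [hmem hT, hmem hT', h]

lemma card_branchPairs (s : Fin 2) : (branchPairs m s).card = 2 * m - 1 := by
  rw [branchPairs, Finset.card_erase_of_mem (Finset.mem_univ _), Finset.card_univ,
    Fintype.card_prod, Fintype.card_fin, Fintype.card_fin, mul_comm]

lemma multiFactorial_branchOcc (s : Fin 2) (T : Finset (ModePair m)) :
    multiFactorial (branchOcc s T) = 2 ^ (2 * m - 1) := by
  rw [multiFactorial, prod_mode, ← card_branchPairs s, ← Finset.prod_const,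
    ← Finset.univ_inter (branchPairs m s), ← Finset.prod_ite_mem]
  refine Finset.prod_congr rfl fun p _ => ?_
  simp only [branchOcc_apply, Fin.prod_univ_two]
  by_cases h1 : p ∈ branchPairs m s <;> by_cases h2 : p ∈ T <;> simp [h1, h2]

/-- A set `T` consists of `k` of the `m` pairs in row `s` and an arbitrary subset of the `m - 1`
pairs in the other row. -/
lemma card_subsets_rowCard (s : Fin 2) (k : ℕ) :
    ((branchPairs m s).powerset.filter fun T => rowCard s T = k).card =
      m.choose k * 2 ^ (m - 1) := by
  set A := (branchPairs m s).filter fun p => p.2 = s with hA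
  set B := (branchPairs m s).filter fun p => ¬ p.2 = s with hB
  have hAcard : A.card = m := by
    change rowCard s (branchPairs m s) = m
    rw [rowCard_eq]
    have : ∀ i : Fin m, ((i, s) : ModePair m) ∈ branchPairs m s := by
      intro i
      have hs : s ≠ s + 1 := by fin_cases s <;> decide
      simp [branchPairs, hs]
    simp [this]
  have hBcard : B.card = m - 1 := by
    have h := Finset.card_filter_add_card_filter_not (s := branchPairs m s) (fun p => p.2 = s)
    rw [← hA, ← hB, hAcard, card_branchPairs] at h
    omega
  have hcard : (Finset.powersetCard k A ×ˢ B.powerset).card = m.choose k * 2 ^ (m - 1) := by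
    rw [Finset.card_product, Finset.card_powersetCard, Finset.card_powerset, hAcard, hBcard]
  rw [← hcard]
  have hAm : ∀ {p}, p ∈ A ↔ p ∈ branchPairs m s ∧ p.2 = s := by
    intro p
    rw [hA, Finset.mem_filter]
  have hBm : ∀ {p}, p ∈ B ↔ p ∈ branchPairs m s ∧ ¬ p.2 = s := by
    intro p
    rw [hB, Finset.mem_filter]
  refine Finset.card_nbij'
    (fun T => (T.filter fun p => p.2 = s, T.filter fun p => ¬ p.2 = s))
    (fun U => U.1 ∪ U.2) ?_ ?_ ?_ ?_
  · intro T hT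
    obtain ⟨hT, hk⟩ := Finset.mem_filter.mp hT
    rw [Finset.mem_powerset] at hT
    rw [Finset.mem_coe, Finset.mem_product, Finset.mem_powersetCard, Finset.mem_powerset]
    exact ⟨⟨Finset.filter_subset_filter _ hT, hk⟩, Finset.filter_subset_filter _ hT⟩
  · rintro ⟨U, V⟩ hUV
    rw [Finset.mem_coe, Finset.mem_product, Finset.mem_powersetCard, Finset.mem_powerset] at hUV
    obtain ⟨⟨hU, hk⟩, hV⟩ := hUV
    rw [Finset.mem_coe, Finset.mem_filter, Finset.mem_powerset]
    refine ⟨Finset.union_subset (fun p hp => (hAm.mp (hU hp)).1)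
      fun p hp => (hBm.mp (hV hp)).1, ?_⟩
    rw [rowCard, ← hk]
    congr 1
    ext p
    simp only [Finset.mem_filter, Finset.mem_union]
    constructor
    · rintro ⟨h1 | h1, h2⟩
      · exact h1
      · exact absurd h2 (hBm.mp (hV h1)).2
    · exact fun h => ⟨Or.inl h, (hAm.mp (hU h)).2⟩
  · intro T _
    exact Finset.filter_union_filter_not_eq _ T
  · rintro ⟨U, V⟩ hUV
    rw [Finset.mem_coe, Finset.mem_product, Finset.mem_powersetCard, Finset.mem_powerset] at hUV
    obtain ⟨⟨hU, hk⟩, hV⟩ := hUV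
    refine Prod.ext ?_ ?_
    · ext p
      simp only [Finset.mem_filter, Finset.mem_union]
      constructor
      · rintro ⟨h1 | h1, h2⟩
        · exact h1
        · exact absurd h2 (hBm.mp (hV h1)).2
      · exact fun h => ⟨Or.inl h, (hAm.mp (hU h)).2⟩
    · ext p
      simp only [Finset.mem_filter, Finset.mem_union]
      constructor
      · rintro ⟨h1 | h1, h2⟩
        · exact absurd (hAm.mp (hU h1)).2 h2
        · exact h1
      · exact fun h => ⟨Or.inr h, (hBm.mp (hV h)).2⟩

lemma card_levelLabels (k : ℕ) : (levelLabels m k).card = 2 * (m.choose k * 2 ^ (m - 1)) := by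
  rw [levelLabels, Finset.card_filter, Fintype.sum_prod_type]
  have : ∀ s : Fin 2, (∑ T : Finset (ModePair m),
      if T ⊆ branchPairs m s ∧ rowCard s T = k then 1 else 0) = m.choose k * 2 ^ (m - 1) := by
    intro s
    rw [← card_subsets_rowCard s k, ← Finset.card_filter]
    congr 1
    ext T
    simp
  rw [Finset.sum_congr rfl fun s _ => this s]
  simp

lemma norm_branchNorm_sq (m : ℕ) : ‖branchNorm m‖ ^ 2 = 1 / 2 * ((1 / 2) ^ (2 * m - 1)) ^ 2 := by
  rw [branchNorm, norm_mul, mul_pow, Complex.norm_real, Real.norm_eq_abs, sq_abs,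
    one_div_sqrt_two_sq, norm_pow]
  norm_num

/-- There are `2 ^ m * m.choose k` labels, each with monomial norm `2 ^ (2 * m - 1)` and squared
amplitude `2 ^ (-(4 * m - 1))`. -/
lemma fockInner_levelState (k : ℕ) :
    fockInner (levelState m k) (levelState m k) = ((m.choose k / 2 ^ m : ℝ) : ℂ) := by
  have hm := NeZero.pos m
  have hnorm : ∀ a : Fin 2 × Finset (ModePair m),
      ‖branchNorm m * (-1) ^ (a.1 : ℕ) * ∏ _p ∈ a.2, (-1)‖ ^ 2 =
        1 / 2 * ((1 / 2) ^ (2 * m - 1)) ^ 2 := by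
    intro a
    rw [Finset.prod_const, norm_mul, norm_mul, norm_pow, norm_pow, norm_neg, norm_one, one_pow,
      one_pow, mul_one, mul_one, norm_branchNorm_sq]
  rw [levelState, fockInner_sum_monomial _ _ (branchOcc_injOn k)]
  simp only [multiFactorial_branchOcc, hnorm, Finset.sum_const, card_levelLabels, nsmul_eq_mul]
  obtain ⟨l, rfl⟩ := Nat.exists_eq_add_of_le' hm
  have e : 2 * (l + 1) - 1 = l + l + 1 := by omega
  rw [e, Nat.add_sub_cancel]
  push_cast
  rw [pow_succ, pow_succ, pow_succ, pow_add, pow_add, one_div, inv_pow]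
  field_simp
  ring

lemma total_inputPhotons (x : TwoQubit) : ∑ q, inputPhotons m x q = 2 + 4 * (m - 1) := by
  rw [Fintype.sum_prod_type, ← Finset.add_sum_erase _ _ (Finset.mem_univ (0 : Fin m))]
  refine congrArg₂ (· + ·) ?_ ?_
  · obtain ⟨x, y⟩ := x
    fin_cases x <;> fin_cases y <;> simp [inputPhotons] <;> rfl
  · rw [Finset.sum_congr rfl (g := fun _ => 4)]
    · simp [mul_comm]
    · intro j hj
      have hj' : j ≠ 0 := Finset.ne_of_mem_erase hj
      simp [inputPhotons, hj']

lemma inputPhotons_le_one (x : TwoQubit) (q : Mode m) : inputPhotons m x q ≤ 1 := by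
  simp only [inputPhotons, Finsupp.equivFunOnFinite_symm_apply_apply]
  split_ifs <;> simp

lemma multiFactorial_inputPhotons (x : TwoQubit) : multiFactorial (inputPhotons m x) = 1 :=
  Finset.prod_eq_one fun q _ => Nat.factorial_eq_one.mpr (inputPhotons_le_one x q)

lemma inputPhotons_injective : Function.Injective (inputPhotons m) := by
  have h : ∀ x : TwoQubit, x = (if inputPhotons m x (0, 0, 0) = 1 then 0 else 1,
      if inputPhotons m x (0, 1, 0) = 1 then 0 else 1) := by
    rintro ⟨x, y⟩
    fin_cases x <;> fin_cases y <;> simp [inputPhotons]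
  intro x y hxy
  rw [h x, h y, hxy]

lemma inputState_eq (v : TwoQubit → ℂ) :
    inputState m v = ∑ x, monomial (inputPhotons m x) (v x) := by
  simp [inputState, C_mul_monomial]

lemma fockInner_inputState (v : TwoQubit → ℂ) :
    fockInner (inputState m v) (inputState m v) = ((∑ x, ‖v x‖ ^ 2 : ℝ) : ℂ) := by
  rw [inputState_eq, fockInner_sum_monomial _ _ inputPhotons_injective.injOn]
  simp [multiFactorial_inputPhotons]

lemma coeff_inputState_of_notMem_patterns (v : TwoQubit → ℂ) {n : Mode m →₀ ℕ}
    (hn : n ∉ patterns m) : coeff n (linSubst (circuit m) (inputState m v)) = 0 := by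
  by_contra h
  have hw : ∀ n : Mode m →₀ ℕ, Finsupp.weight (fun _ : Mode m => 1) n = ∑ q, n q := by
    intro n
    rw [Finsupp.weight_apply, Finsupp.sum_fintype _ _ fun i => by simp]
    simp
  have hP : IsWeightedHomogeneous (fun _ : Mode m => 1) (inputState m v) (2 + 4 * (m - 1)) := by
    rw [inputState_eq]
    refine IsWeightedHomogeneous.sum _ _ _ fun x _ => isWeightedHomogeneous_monomial _ _ _ ?_
    rw [hw, total_inputPhotons]
  have := linSubst_isWeightedHomogeneous (U := circuit m) (fun _ _ _ => rfl) hP h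
  rw [hw] at this
  exact hn (Finset.mem_finsuppAntidiag.mpr ⟨this, Finset.subset_univ _⟩)

end Norms

/-! ### Sorting of detection patterns into outcomes -/

section Outcomes

variable {m : ℕ} [NeZero m]

/-- Parities of the photon numbers of a detection pattern. -/
def parity (n : Mode m →₀ ℕ) : Fin 2 × Fin 2 := Finsupp.weight (fun q : Mode m => q.2) n

lemma pairVar_homogeneous (p : ModePair m) (t : Fin 2) :
    IsWeightedHomogeneous (fun q : Mode m => q.2) (pairVar p t) (p.2, t) :=
  isWeightedHomogeneous_X _ _ _

/-- Weights add modulo two, so bunched pairs are invisible to the parity. Ancillas and branches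
therefore have parity zero. -/
lemma pairVar_sq_homogeneous (p : ModePair m) (t : Fin 2) :
    IsWeightedHomogeneous (fun q : Mode m => q.2) (pairVar p t ^ 2) 0 := by
  have h : ∀ a : Fin 2 × Fin 2, 2 • a = 0 := by decide
  have := (pairVar_homogeneous p t).pow 2
  rwa [h] at this

lemma prod_homogeneous_zero {ι : Type} (s : Finset ι) {f : ι → MvPolynomial (Mode m) ℂ}
    (h : ∀ i, IsWeightedHomogeneous (fun q : Mode m => q.2) (f i) 0) :
    IsWeightedHomogeneous (fun q : Mode m => q.2) (∏ i ∈ s, f i) 0 := by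
  have := IsWeightedHomogeneous.prod s f (fun _ => 0) (w := fun q : Mode m => q.2) fun i _ => h i
  rwa [Finset.sum_const_zero] at this

lemma ancilla_homogeneous :
    IsWeightedHomogeneous (fun q : Mode m => q.2) (ancilla m) 0 :=
  prod_homogeneous_zero _ fun _ => prod_homogeneous_zero _ fun _ =>
    ((pairVar_sq_homogeneous _ _).sub (pairVar_sq_homogeneous _ _)).C_mul _

lemma branchState_homogeneous (σ : ModePair m → ℂ) (s : Fin 2) :
    IsWeightedHomogeneous (fun q : Mode m => q.2) (branchState σ s) 0 :=
  prod_homogeneous_zero _ fun _ =>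
    (pairVar_sq_homogeneous _ _).add ((pairVar_sq_homogeneous _ _).C_mul _)

/-- The parities that the four Bell states lead to. -/
def bellParity : Fin 4 → Fin 2 × Fin 2 := ![(0, 1), (1, 1), 0, 0]

lemma linSubst_firstLayer_bell_homogeneous (b : Fin 4) :
    IsWeightedHomogeneous (fun q : Mode m => q.2)
      (linSubst (firstLayer m) (inputState m (bell b))) (bellParity b) := by
  fin_cases b
  · change IsWeightedHomogeneous _ (linSubst (firstLayer m) (inputState m psiPlus)) _
    rw [linSubst_firstLayer_psiPlus]
    have h1 := (pairVar_homogeneous ((0, 0) : ModePair m) 0).mul (pairVar_homogeneous (0, 0) 1)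
    have h2 := (pairVar_homogeneous ((0, 1) : ModePair m) 0).mul (pairVar_homogeneous (0, 1) 1)
    exact ((h1.sub h2).C_mul _).mul ancilla_homogeneous
  · change IsWeightedHomogeneous _ (linSubst (firstLayer m) (inputState m psiMinus)) _
    rw [linSubst_firstLayer_psiMinus]
    have h1 := (pairVar_homogeneous ((0, 1) : ModePair m) 0).mul (pairVar_homogeneous (0, 0) 1)
    have h2 := (pairVar_homogeneous ((0, 0) : ModePair m) 0).mul (pairVar_homogeneous (0, 1) 1)
    exact ((h1.sub h2).C_mul _).mul ancilla_homogeneous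
  · change IsWeightedHomogeneous _ (linSubst (firstLayer m) (inputState m phiPlus)) _
    rw [linSubst_firstLayer_phiPlus]
    exact ((branchState_homogeneous _ _).sub (branchState_homogeneous _ _)).C_mul _
  · change IsWeightedHomogeneous _ (linSubst (firstLayer m) (inputState m phiMinus)) _
    rw [linSubst_firstLayer_phiMinus]
    exact ((branchState_homogeneous _ _).sub (branchState_homogeneous _ _)).C_mul _

/-- The amplitude of a detection pattern for a Bell state, up to normalization. -/
def bellAmplitude (b : Fin 4) (n : Mode m →₀ ℕ) : ℂ :=
  coeff n (linSubst (circuit m) (inputState m (bell b)))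

lemma linSubst_circuit (p : MvPolynomial (Mode m) ℂ) :
    linSubst (circuit m) p = linSubst (secondLayer m) (linSubst (firstLayer m) p) := by
  rw [circuit_eq, linSubst_mul, AlgHom.comp_apply]

lemma bellAmplitude_eq_zero_of_parity {b : Fin 4} {n : Mode m →₀ ℕ}
    (h : parity n ≠ bellParity b) : bellAmplitude b n = 0 := by
  rw [bellAmplitude, linSubst_circuit]
  exact (linSubst_isWeightedHomogeneous (fun _ _ hqr => secondLayer_ne_zero hqr)
    (linSubst_firstLayer_bell_homogeneous b)).coeff_eq_zero n h

lemma bellAmplitude_three (n : Mode m →₀ ℕ) : bellAmplitude 3 n = branchNorm m *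
    (coeff n (linSubst (secondLayer m) (branchState (fun _ => -1) 0)) -
      coeff n (linSubst (secondLayer m) (branchState (fun _ => -1) 1))) := by
  change coeff n (linSubst (circuit m) (inputState m phiMinus)) = _
  rw [linSubst_circuit, linSubst_firstLayer_phiMinus, map_mul, linSubst_C, map_sub, coeff_C_mul,
    coeff_sub]

lemma bellAmplitude_two (n : Mode m →₀ ℕ) : bellAmplitude 2 n = branchNorm m *
    (coeff n (linSubst (secondLayer m) (branchState (flipSign (0, 0)) 0)) -
      coeff n (linSubst (secondLayer m) (branchState (flipSign (0, 1)) 1))) := by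
  change coeff n (linSubst (circuit m) (inputState m phiPlus)) = _
  rw [linSubst_circuit, linSubst_firstLayer_phiPlus, map_mul, linSubst_C, map_sub, coeff_C_mul,
    coeff_sub]

lemma bellAmplitude_three_of_not_neutral {n : Mode m →₀ ℕ} (h : ¬ Neutral n) :
    bellAmplitude 3 n = 0 := by
  rw [bellAmplitude_three, coeff_branchState_of_not_neutral _ h,
    coeff_branchState_of_not_neutral _ h, sub_zero, mul_zero]

lemma bellAmplitude_three_of_lt_level {n : Mode m →₀ ℕ} (h : m < level n) :
    bellAmplitude 3 n = 0 := by
  rw [bellAmplitude_three, coeff_branchState_of_lt_level _ _ h,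
    coeff_branchState_of_lt_level _ _ h, sub_zero, mul_zero]

lemma bellAmplitude_two_of_neutral {n : Mode m →₀ ℕ} (h : Neutral n) :
    bellAmplitude 2 n = ((m : ℂ) - 2 * level n) / m * bellAmplitude 3 n := by
  rw [bellAmplitude_two, bellAmplitude_three, coeff_branchState_flipSign h,
    coeff_branchState_flipSign h]
  ring

/-- The probability of a detection pattern for a Bell state. -/
def bellProb (b : Fin 4) (n : Mode m →₀ ℕ) : ℝ := multiFactorial n * ‖bellAmplitude b n‖ ^ 2

lemma fockInner_self_eq_sum (p : MvPolynomial (Mode m) ℂ) {s : Finset (Mode m →₀ ℕ)}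
    (hs : ∀ n ∉ s, coeff n p = 0) :
    fockInner p p = ((∑ n ∈ s, (multiFactorial n : ℝ) * ‖coeff n p‖ ^ 2 : ℝ) : ℂ) := by
  rw [fockInner_eq_sum p hs]
  push_cast
  refine Finset.sum_congr rfl fun n _ => ?_
  rw [RCLike.star_def, Complex.conj_mul']

lemma sum_norm_sq_bell (b : Fin 4) : ∑ x, ‖bell b x‖ ^ 2 = 1 := by
  have h := one_div_sqrt_two_sq
  rw [one_div, inv_pow] at h
  fin_cases b <;>
    simp [Fintype.sum_prod_type, bell, psiPlus, psiMinus, phiPlus, phiMinus, ofReals] <;> norm_num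

lemma sum_bellProb (b : Fin 4) : ∑ n ∈ patterns m, bellProb b n = 1 := by
  have h := fockInner_self_eq_sum (linSubst (circuit m) (inputState m (bell b)))
    fun n hn => coeff_inputState_of_notMem_patterns _ hn
  rw [fockInner_linSubst (circuit_unitary (NeZero.pos m)), fockInner_inputState,
    sum_norm_sq_bell] at h
  exact (Complex.ofReal_injective h).symm

lemma sum_bellProb_level (k : ℕ) :
    ∑ n ∈ patterns m, (if level n = k then bellProb 3 n else 0) = (m.choose k : ℝ) / 2 ^ m := by
  have hc : ∀ n : Mode m →₀ ℕ, coeff n (linSubst (secondLayer m) (levelState m k)) =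
      if level n = k then bellAmplitude 3 n else 0 := by
    intro n
    rw [coeff_levelState, ← linSubst_circuit]
    rfl
  have h := fockInner_self_eq_sum (linSubst (secondLayer m) (levelState m k)) (s := patterns m)
    fun n hn => by
      rw [hc, bellAmplitude, coeff_inputState_of_notMem_patterns _ hn, ite_self]
  rw [fockInner_linSubst (secondLayer_unitary (NeZero.pos m)), fockInner_levelState] at h
  rw [Complex.ofReal_injective h]
  refine Finset.sum_congr rfl fun n _ => ?_
  rw [hc]
  split_ifs
  · rfl
  · simp

lemma star_bell (b : Fin 4) (x : TwoQubit) : star (bell b x) = bell b x := by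
  fin_cases b <;> exact Complex.conj_ofReal _

lemma bra_eq_sum_bell (k : TwoQubit → ℂ) : k = ∑ b, applyBra k (bell b) • bell b := by
  ext y
  have h : ∀ x, ∑ b, bell b x * bell b y = if x = y then 1 else 0 := by
    intro x
    rw [← Matrix.one_apply, ← sum_effect_bell, Matrix.sum_apply]
    exact Finset.sum_congr rfl fun b _ => by rw [effect_apply, star_bell]
  simp only [Finset.sum_apply, Pi.smul_apply, smul_eq_mul, applyBra, Finset.sum_mul, mul_assoc]
  rw [Finset.sum_comm]
  simp only [← Finset.mul_sum, h]
  simp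

lemma applyBra_patternBra (n : Mode m →₀ ℕ) (v : TwoQubit → ℂ) :
    applyBra (patternBra m n) v =
      ((√(multiFactorial n) : ℝ) : ℂ) * coeff n (linSubst (circuit m) (inputState m v)) := by
  simp only [applyBra, patternBra, fockAmplitude_eq, multiFactorial_inputPhotons, inputState,
    map_sum, map_mul, linSubst_C, coeff_sum, coeff_C_mul, Finset.mul_sum]
  refine Finset.sum_congr rfl fun x _ => ?_
  rw [Nat.cast_one, Real.sqrt_one, div_one]
  ring

lemma patternBra_eq (n : Mode m →₀ ℕ) :
    patternBra m n = ∑ b, (((√(multiFactorial n) : ℝ) : ℂ) * bellAmplitude b n) • bell b := by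
  rw [bra_eq_sum_bell (patternBra m n)]
  exact Finset.sum_congr rfl fun b _ => by rw [applyBra_patternBra, bellAmplitude]

lemma sum_effect_patternBra {s : Finset (Mode m →₀ ℕ)} {k : TwoQubit → ℂ} {b : Fin 4}
    (h : ∀ n ∈ s, patternBra m n = (((√(multiFactorial n) : ℝ) : ℂ) * bellAmplitude b n) • k) :
    ∑ n ∈ s, effect (patternBra m n) = ((∑ n ∈ s, bellProb b n : ℝ) : ℂ) • effect k := by
  rw [Complex.ofReal_sum, Finset.sum_smul]
  refine Finset.sum_congr rfl fun n hn => ?_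
  rw [h n hn, effect_smul, norm_mul, mul_pow, Complex.norm_real, Real.norm_eq_abs, sq_abs,
    Real.sq_sqrt (Nat.cast_nonneg _), bellProb]

open Classical in
/-- The outcome into which a detection pattern is sorted. -/
def outcome (n : Mode m →₀ ℕ) : Outcome m :=
  if parity n = (0, 1) then Sum.inl 0
  else if parity n = (1, 1) then Sum.inl 1
  -- Patterns that get here with parity `(1, 0)` or level above `m` have amplitude zero for all Bell
  -- states, so their assignment is immaterial.
  else if h : Neutral n ∧ level n < m + 1 then Sum.inr ⟨level n, h.2⟩
  else Sum.inl 2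

lemma outcome_eq_inl_zero {n : Mode m →₀ ℕ} : outcome n = Sum.inl 0 ↔ parity n = (0, 1) := by
  unfold outcome
  split_ifs with h1 h2 h3 <;> simp [h1]

lemma outcome_eq_inl_one {n : Mode m →₀ ℕ} : outcome n = Sum.inl 1 ↔ parity n = (1, 1) := by
  unfold outcome
  split_ifs with h1 h2 h3 <;> simp_all

lemma outcome_eq_inl_two {n : Mode m →₀ ℕ} : outcome n = Sum.inl 2 ↔
    parity n ≠ (0, 1) ∧ parity n ≠ (1, 1) ∧ ¬ (Neutral n ∧ level n < m + 1) := by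
  unfold outcome
  split_ifs with h1 h2 h3
  · simp [h1]
  · simp [h2]
  · simp [h3]
  · exact ⟨fun _ => ⟨h1, h2, h3⟩, fun _ => rfl⟩

lemma outcome_eq_inr {n : Mode m →₀ ℕ} {k : Fin (m + 1)} : outcome n = Sum.inr k ↔
    parity n ≠ (0, 1) ∧ parity n ≠ (1, 1) ∧ Neutral n ∧ level n = k := by
  unfold outcome
  split_ifs with h1 h2 h3
  · simp [h1]
  · simp [h2]
  · simp [h1, h2, h3.1, Fin.ext_iff]
  · simp only [false_iff]
    rintro ⟨_, _, h4, h5⟩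
    exact h3 ⟨h4, h5 ▸ k.2⟩

lemma bellAmplitude_three_of_outcome {n : Mode m →₀ ℕ} (h : ∀ k, outcome n ≠ Sum.inr k) :
    bellAmplitude 3 n = 0 := by
  by_contra hne
  have hp : parity n = 0 := by
    by_contra hp
    exact hne (bellAmplitude_eq_zero_of_parity hp)
  have hn : Neutral n := by
    by_contra hn
    exact hne (bellAmplitude_three_of_not_neutral hn)
  have hl : level n < m + 1 := by
    by_contra hl
    exact hne (bellAmplitude_three_of_lt_level (by omega))
  refine h ⟨level n, hl⟩ (outcome_eq_inr.mpr ⟨?_, ?_, hn, rfl⟩) <;> rw [hp] <;> decide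

/-- Patterns of level `k` sorted elsewhere have no `φ⁻` amplitude, so the outcome carries the whole
probability of its level. -/
lemma sum_filter_outcome_inr (k : Fin (m + 1)) :
    ∑ n ∈ (patterns m).filter (fun n => outcome n = Sum.inr k), bellProb 3 n =
      (m.choose k : ℝ) / 2 ^ m := by
  rw [← sum_bellProb_level, Finset.sum_filter]
  refine Finset.sum_congr rfl fun n _ => ?_
  by_cases h : outcome n = Sum.inr k
  · rw [if_pos h, if_pos (outcome_eq_inr.mp h).2.2.2]
  · rw [if_neg h]
    split_ifs with hl
    · have : bellAmplitude 3 n = 0 := by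
        refine bellAmplitude_three_of_outcome fun k' hk' => h ?_
        rw [hk']
        congr 1
        exact Fin.ext ((outcome_eq_inr.mp hk').2.2.2.symm.trans hl)
      simp [bellProb, this]
    · rfl

lemma bellProb_two_of_outcome_inr {n : Mode m →₀ ℕ} {k : Fin (m + 1)}
    (h : outcome n = Sum.inr k) :
    bellProb 2 n = (((m : ℝ) - 2 * (k : ℕ)) / m) ^ 2 * bellProb 3 n := by
  obtain ⟨_, _, hn, hl⟩ := outcome_eq_inr.mp h
  have hc : ((m : ℂ) - 2 * (k : ℕ)) / m = ((((m : ℝ) - 2 * (k : ℕ)) / m : ℝ) : ℂ) := by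
    push_cast
    rfl
  rw [bellProb, bellProb, bellAmplitude_two_of_neutral hn, hl, hc, norm_mul, Complex.norm_real,
    mul_pow, Real.norm_eq_abs, sq_abs]
  ring

/-- Obtained as a complement: for the input `φ⁺` the outcomes `ψ±` never occur, and the `K_k` take
the share `1/m` by the binomial variance. -/
lemma sum_filter_outcome_inl_two :
    ∑ n ∈ (patterns m).filter (fun n => outcome n = Sum.inl 2), bellProb 2 n = 1 - 1 / m := by
  have hm : (m : ℝ) ≠ 0 := NeZero.ne _
  have h := Finset.sum_fiberwise (patterns m) outcome (fun n => bellProb 2 n)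
  rw [sum_bellProb, Fintype.sum_sum_type, Fin.sum_univ_three] at h
  have h0 : ∑ n ∈ (patterns m).filter (fun n => outcome n = Sum.inl 0), bellProb 2 n = 0 := by
    refine Finset.sum_eq_zero fun n hn => ?_
    have hp := outcome_eq_inl_zero.mp (Finset.mem_filter.mp hn).2
    rw [bellProb, bellAmplitude_eq_zero_of_parity (by rw [hp]; decide)]
    simp
  have h1 : ∑ n ∈ (patterns m).filter (fun n => outcome n = Sum.inl 1), bellProb 2 n = 0 := by
    refine Finset.sum_eq_zero fun n hn => ?_
    have hp := outcome_eq_inl_one.mp (Finset.mem_filter.mp hn).2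
    rw [bellProb, bellAmplitude_eq_zero_of_parity (by rw [hp]; decide)]
    simp
  have hk : ∀ k : Fin (m + 1),
      ∑ n ∈ (patterns m).filter (fun n => outcome n = Sum.inr k), bellProb 2 n =
        1 / m ^ 2 * ((m.choose k : ℝ) / 2 ^ m * ((m : ℝ) - 2 * (k : ℕ)) ^ 2) := by
    intro k
    rw [Finset.sum_congr rfl fun n hn => bellProb_two_of_outcome_inr (Finset.mem_filter.mp hn).2,
      ← Finset.mul_sum, sum_filter_outcome_inr, div_pow]
    ring
  rw [h0, h1, Finset.sum_congr rfl fun k _ => hk k, ← Finset.mul_sum,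
    Fin.sum_univ_eq_sum_range (fun k => (m.choose k : ℝ) / 2 ^ m * ((m : ℝ) - 2 * k) ^ 2),
    sum_choose_div_mul_sq] at h
  have e : 1 / (m : ℝ) ^ 2 * m = 1 / m := by field_simp
  rw [e] at h
  linarith

lemma sum_filter_outcome_of_parity {b : Fin 4} {o : Outcome m}
    (h : ∀ n : Mode m →₀ ℕ, outcome n = o ↔ parity n = bellParity b) :
    ∑ n ∈ (patterns m).filter (fun n => outcome n = o), bellProb b n = 1 := by
  rw [← sum_bellProb (m := m) b, Finset.sum_filter]
  refine Finset.sum_congr rfl fun n _ => ?_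
  split_ifs with hn
  · rfl
  · rw [h] at hn
    rw [bellProb, bellAmplitude_eq_zero_of_parity hn]
    simp

/-- The linear optical circuit realizes the two-qubit measurement. -/
lemma circuitRealizes_bellKraus : CircuitRealizes m (bellKraus m) := by
  have hzero : ∀ {b : Fin 4} {n : Mode m →₀ ℕ} {a : Fin 2 × Fin 2}, parity n = a →
      a ≠ bellParity b → bellAmplitude b n = 0 := by
    intro b n a hn ha
    exact bellAmplitude_eq_zero_of_parity (hn ▸ ha)
  refine ⟨outcome, ?_⟩
  rintro (i | k)
  · fin_cases i
    · have h : ∀ n ∈ (patterns m).filter (fun n => outcome n = Sum.inl 0), patternBra m n =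
          (((√(multiFactorial n) : ℝ) : ℂ) * bellAmplitude 0 n) • bell 0 := by
        intro n hn
        have hp := outcome_eq_inl_zero.mp (Finset.mem_filter.mp hn).2
        rw [patternBra_eq, Fin.sum_univ_four, hzero (b := 1) hp (by decide),
          hzero (b := 2) hp (by decide), hzero (b := 3) hp (by decide)]
        simp
      refine (sum_effect_patternBra h).trans ?_
      rw [sum_filter_outcome_of_parity fun n => outcome_eq_inl_zero, Complex.ofReal_one, one_smul]
      rfl
    · have h : ∀ n ∈ (patterns m).filter (fun n => outcome n = Sum.inl 1), patternBra m n =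
          (((√(multiFactorial n) : ℝ) : ℂ) * bellAmplitude 1 n) • bell 1 := by
        intro n hn
        have hp := outcome_eq_inl_one.mp (Finset.mem_filter.mp hn).2
        rw [patternBra_eq, Fin.sum_univ_four, hzero (b := 0) hp (by decide),
          hzero (b := 2) hp (by decide), hzero (b := 3) hp (by decide)]
        simp
      refine (sum_effect_patternBra h).trans ?_
      rw [sum_filter_outcome_of_parity fun n => outcome_eq_inl_one, Complex.ofReal_one, one_smul]
      rfl
    · have h : ∀ n ∈ (patterns m).filter (fun n => outcome n = Sum.inl 2), patternBra m n =
          (((√(multiFactorial n) : ℝ) : ℂ) * bellAmplitude 2 n) • bell 2 := by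
        intro n hn
        have ho := (Finset.mem_filter.mp hn).2
        obtain ⟨h0, h1, _⟩ := outcome_eq_inl_two.mp ho
        have h3 : bellAmplitude 3 n = 0 :=
          bellAmplitude_three_of_outcome fun k hk => by simp [hk] at ho
        rw [patternBra_eq, Fin.sum_univ_four, bellAmplitude_eq_zero_of_parity (b := 0) h0,
          bellAmplitude_eq_zero_of_parity (b := 1) h1, h3]
        simp
      refine (sum_effect_patternBra h).trans ?_
      rw [sum_filter_outcome_inl_two, ← norm_sq_sqrt_one_sub (NeZero.pos m), ← effect_smul]
      rfl
  · have h : ∀ n ∈ (patterns m).filter (fun n => outcome n = Sum.inr k), patternBra m n =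
        (((√(multiFactorial n) : ℝ) : ℂ) * bellAmplitude 3 n) •
          (phiMinus + ((((m : ℝ) - 2 * (k : ℕ)) / m : ℝ) : ℂ) • phiPlus) := by
      intro n hn
      obtain ⟨h0, h1, hn, hl⟩ := outcome_eq_inr.mp (Finset.mem_filter.mp hn).2
      rw [patternBra_eq, Fin.sum_univ_four, bellAmplitude_eq_zero_of_parity (b := 0) h0,
        bellAmplitude_eq_zero_of_parity (b := 1) h1, bellAmplitude_two_of_neutral hn, hl,
        mul_zero, zero_smul, zero_smul, smul_add, smul_smul, add_comm _ (_ • bell 3)]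
      push_cast
      rw [zero_add, zero_add, mul_left_comm, mul_comm (_ / _)]
      rfl
    rw [sum_effect_patternBra h, sum_filter_outcome_inr, ← norm_sq_sqrt_div, ← effect_smul]
    rfl

end Outcomes

end BellLOC

end

open BellLOC
theorem corollary3 :
    -- the linear optical circuit realizes the two-qubit measurement `bellKraus m`
    (∀ m : ℕ, 1 ≤ m → CircuitRealizes m (bellKraus m)) ∧
    -- the average success probability of Bell-state discrimination for even `m`
    (∀ m : ℕ, 1 ≤ m → Even m →
      successProb (bellKraus m) =
        1 / 4 * (3 - 1 / (m : ℝ) + (m.choose (m / 2) : ℝ) * (1 / 2 ^ m))) ∧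
    -- the relative entropy of entanglement
    (∀ m : ℕ, 1 ≤ m →
      measurementREE (bellKraus m) = ((entanglementValue m : ℝ) : EReal) ∧
      averageREE (bellKraus m) = ((entanglementValue m : ℝ) : EReal)) ∧
    -- the limits
    Filter.Tendsto (fun m : ℕ => successProb (bellKraus m)) Filter.atTop (nhds (3 / 4)) ∧
    Filter.Tendsto (fun m : ℕ => measurementREE (bellKraus m)) Filter.atTop (nhds 1) ∧
    Filter.Tendsto (fun m : ℕ => averageREE (bellKraus m)) Filter.atTop (nhds 1) ∧
    -- the maximum
    successProb (bellKraus 8) = 403 / 512 ∧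
    (∀ m : ℕ, 1 ≤ m → successProb (bellKraus m) ≤ 403 / 512) := by
  refine ⟨fun m hm => ?_, fun m hm he => ?_,
    fun m hm => ⟨measurementREE_bellKraus hm, averageREE_bellKraus hm⟩, tendsto_successProb,
    tendsto_measurementREE, tendsto_averageREE, successProb_eight, fun m hm => successProb_le hm⟩
  · have : NeZero m := ⟨by omega⟩
    exact circuitRealizes_bellKraus
  · rw [successProb_bellKraus hm, centralWeight, if_pos he, mul_one_div]
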